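/- Let $\Delta=n+2\ge 4$, $k\in\mathbb R$ (normalised to $1,0,-1$ if one wishes) and $C>0$. **Setting.** Let $\mathcal Q\subset\mathbb R^2$ be a region with null coordinates $(u,v)$, both increasing to the future. Its boundary curves are an initial connected spacelike curve $S\subset\mathcal Q$, with no other point of $\mathcal Q$ in the causal past of a point of $S$, and a connected timelike curve $\Gamma\subset\mathcal Q$ (the centre). They meet in one point, and the interior of $\mathcal Q$ is $\mathcal Q\setminus(S\cup\Gamma)$. Every null curve $u=\mathrm{const}$ in $\mathcal Q$ starts, in the past, on $S\cup\Gamma$. Every null curve $v=\mathrm{const}$ in $\mathcal Q\setminus\Gamma$ starts on $S$ or at infinity ($r\to\infty$). On $\mathcal Q\setminus\Gamma$ let $r>0$ be $C^2$ and $\Omega>0$ be $C^1$, with the mixed second derivatives of $\Omega$ existing in the interior; let $r$ be continuous on $\mathcal Q$ and $r=0$ on $\Gamma$. Let $\gamma$ be an $n$-dimensional Riemannian metric with $R_{ij}[\gamma]=k(\Delta-3)\gamma_{ij}$. Suppose that $$ds^2=-\Omega^2\,du\,dv+r^2\gamma$$ satisfies the Einstein equations $R_{\mu\nu}-\tfrac12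 g_{\mu\nu}R=2T_{\mu\nu}$, where $T$ is continuous and respects the transverse symmetry ($T_{uu},T_{uv},T_{vv}$ depend only on $(u,v)$, $T_{ui}=T_{vi}=0$, $T_{ij}=P(u,v)\gamma_{ij}$), and $$T_{uu}\ge0,\qquad T_{vv}\ge0,\qquad T_{uv}\ge-|2g_{uv}|\,C .$$ Put $\nu=r_{,u}$, $\lambda=r_{,v}$, $m=\frac{r^{\Delta-3}}2\bigl(k+\frac{4\nu\lambda}{\Omega^2}\bigr)$, and assume $\nu<0$ on $S\setminus\Gamma$ and at infinity. The trapped region is $\mathcal T=\{q\in\mathcal Q:\lambda(q)<0\}$. **First singularities.** Causal pasts $J^-$ and future domains of dependence $D^+$ are taken in the plane with metric $-du\,dv$. For $p\in\overline{\mathcal Q}$ and compact $X\subset\mathcal Q$, say that $X$ generates $p$ if $(J^-(p)\cap\mathcal Q)\cup\{p\}\subset D^+(X)\cup (J^-(X)\cap\mathcal Q)$; $J^-(p)\cap\mathcal Q$ is eventually compactly generated if some such $X$ exists. A first singularity is a point $p\in\overline{\mathcal Q}\setminus\mathcal Q$ such that $J^-(p)\cap\mathcal Q$ is eventually compactly generated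 and, for every $q\in\overline{\mathcal Q}$ with $J^-(q)\cap\mathcal Q$ eventually compactly generated and a proper subset of $J^-(p)\cap\mathcal Q$, there is $z\in\mathcal Q$ with $J^-(q)\cap\mathcal Q=J^-(z)\cap\mathcal Q$. **Claim.** Let $p=(u_s,v_s)\notin\overline\Gamma$ be a first singularity. For $\varepsilon>0$ let $X_\varepsilon=\{u_s-\varepsilon\}\times[v_s-\varepsilon,v_s]\,\cup\,[u_s-\varepsilon,u_s]\times\{v_s-\varepsilon\}$ and $Y_\varepsilon=D^+(X_\varepsilon)\setminus\{p\}$. Then for all sufficiently small $\varepsilon>0$ one has $X_\varepsilon\subset\mathcal Q\setminus\Gamma$, $D^+(X_\varepsilon)=[u_s-\varepsilon,u_s]\times[v_s-\varepsilon,v_s]$, $D^+(X_\varepsilon)\cap\mathcal Q=Y_\varepsilon$ and $Y_\varepsilon\subset\mathcal Q\setminus(S\cup\Gamma)$. For every $\varepsilon>0$ with $Y_\varepsilon\subset\mathcal Q\setminus(S\cup\Gamma)$: 1. If $Y_\varepsilon\cap\mathcal T=\emptyset$, then $m,r,\nu,\lambda,\Omega$ are bounded on $Y_\varepsilon$, and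 $r$ is bounded below there by a positive constant. 2. If $\lambda\ge\lambda_0$ on $Y_\varepsilon$ for some constant $\lambda_0>0$ (the singularity lies in the regular region), then moreover: * $|\nu|$ is bounded below on $Y_\varepsilon$ by a positive constant and $\Omega^{-1}$ is bounded on $Y_\varepsilon$. * The singularity is integrable: the integrals $\int|T_{uu}|\,du$ and $\int|T_{uv}|\,du$ over $[u_s-\varepsilon,u_\star]\times\{v_\star\}$, and $\int|T_{uv}|\,dv$ and $\int|T_{vv}|\,dv$ over $\{u_\star\}\times[v_s-\varepsilon,v_\star]$, are bounded uniformly in $(u_\star,v_\star)\in Y_\varepsilon$. * Assume in addition the extension criterion: for every first singularity $p'\notin\overline\Gamma$ and every compact $X\subset\mathcal Q\setminus\Gamma$ that generates $p'$, $\sup\{|\Omega|_{C^1},|\Omega^{-1}|_{C^0},|r|_{C^2},|r^{-1}|_{C^1}\}=\infty$ on $(D^+(X)\setminus\{p'\})\cap(\mathcal Q\setminus\Gamma)$. Then at least one of the first derivatives of $\Omega,\lambda,\nu$ is unbounded on $Y_\varepsilon$. -/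

import Mathlib

open Set Filter Topology

noncomputable section

namespace Collapse

/-! ### Curvature of a metric in coordinates -/

section Curvature

variable {ι : Type*} [Fintype ι] [DecidableEq ι]

/-- Partial derivative in the coordinate direction `i`. -/
def partialD (i : ι) (f : (ι → ℝ) → ℝ) (x : ι → ℝ) : ℝ :=
  lineDeriv ℝ f x (Pi.single i 1)

/-- Christoffel symbol `Γ^a_{bc}` of the metric `g`. -/
def christoffel (g : (ι → ℝ) → Matrix ι ι ℝ) (a b c : ι) (x : ι → ℝ) : ℝ :=
  (1 / 2) * ∑ d, (g x)⁻¹ a d *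
    (partialD b (fun y => g y d c) x + partialD c (fun y => g y d b) x
      - partialD d (fun y => g y b c) x)

/-- Ricci tensor
`R_{bc} = ∂_a Γ^a_{bc} - ∂_c Γ^a_{ba} + Γ^a_{ad} Γ^d_{bc} - Γ^a_{cd} Γ^d_{ba}`. -/
def ricci (g : (ι → ℝ) → Matrix ι ι ℝ) (b c : ι) (x : ι → ℝ) : ℝ :=
  (∑ a, partialD a (christoffel g a b c) x) - (∑ a, partialD c (christoffel g a b a) x)
    + ∑ a, ∑ d, (christoffel g a a d x * christoffel g d b c x
        - christoffel g a c d x * christoffel g d b a x)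

/-- Scalar curvature. -/
def scalarCurvature (g : (ι → ℝ) → Matrix ι ι ℝ) (x : ι → ℝ) : ℝ :=
  ∑ b, ∑ c, (g x)⁻¹ b c * ricci g b c x

/-- Einstein tensor `R_{bc} - (1/2) g_{bc} R`. -/
def einsteinTensor (g : (ι → ℝ) → Matrix ι ι ℝ) (b c : ι) (x : ι → ℝ) : ℝ :=
  ricci g b c x - (1 / 2) * g x b c * scalarCurvature g x

end Curvature

/-! ### The metric and the stress tensor in the coordinates `(u, v, y)`

The coordinates of the `(n + 2)`-dimensional space-time are indexed by `Fin 2 ⊕ Fin n`: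
`Sum.inl 0` is `u`, `Sum.inl 1` is `v`, and `Sum.inr i` is the transverse coordinate `y i`. -/

/-- The point `(u, v)` of the quotient plane below a point of the space-time. -/
def base {n : ℕ} (x : Fin 2 ⊕ Fin n → ℝ) : ℝ × ℝ := (x (Sum.inl 0), x (Sum.inl 1))

/-- The transverse coordinates of a point of the space-time. -/
def fibre {n : ℕ} (x : Fin 2 ⊕ Fin n → ℝ) : Fin n → ℝ := fun i => x (Sum.inr i)

/-- `g_{uv}` for the metric `-Ω² du dv + r² γ`. -/
def metricUV (Ω : ℝ × ℝ → ℝ) (q : ℝ × ℝ) : ℝ := -(Ω q) ^ 2 / 2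

/-- The metric `-Ω² du dv + r² γ`. -/
def spacetimeMetric {n : ℕ} (Ω r : ℝ × ℝ → ℝ) (γ : (Fin n → ℝ) → Matrix (Fin n) (Fin n) ℝ)
    (x : Fin 2 ⊕ Fin n → ℝ) : Matrix (Fin 2 ⊕ Fin n) (Fin 2 ⊕ Fin n) ℝ :=
  Matrix.fromBlocks !![0, metricUV Ω (base x); metricUV Ω (base x), 0] 0 0
    ((r (base x)) ^ 2 • γ (fibre x))

/-- A stress tensor that respects the transverse symmetry: its `(u, v)` components depend on
`(u, v)` only, its mixed components vanish, and its transverse components are a function of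
`(u, v)` times the transverse metric. -/
def stressTensor {n : ℕ} (Tuu Tuv Tvv P : ℝ × ℝ → ℝ)
    (γ : (Fin n → ℝ) → Matrix (Fin n) (Fin n) ℝ)
    (x : Fin 2 ⊕ Fin n → ℝ) : Matrix (Fin 2 ⊕ Fin n) (Fin 2 ⊕ Fin n) ℝ :=
  Matrix.fromBlocks !![Tuu (base x), Tuv (base x); Tuv (base x), Tvv (base x)] 0 0
    (P (base x) • γ (fibre x))

/-! ### Functions on the plane -/

/-- `∂f/∂u`. -/
def du (f : ℝ × ℝ → ℝ) (q : ℝ × ℝ) : ℝ := deriv (fun u => f (u, q.2)) q.1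

/-- `∂f/∂v`. -/
def dv (f : ℝ × ℝ → ℝ) (q : ℝ × ℝ) : ℝ := deriv (fun v => f (q.1, v)) q.2

/-- The `C⁰` norm on `Y`, possibly infinite. -/
def c0Norm (f : ℝ × ℝ → ℝ) (Y : Set (ℝ × ℝ)) : ENNReal := ⨆ q ∈ Y, ENNReal.ofReal |f q|

/-- The `C¹` norm on `Y`, possibly infinite. -/
def c1Norm (f : ℝ × ℝ → ℝ) (Y : Set (ℝ × ℝ)) : ENNReal :=
  c0Norm f Y ⊔ c0Norm (du f) Y ⊔ c0Norm (dv f) Y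

/-- The `C²` norm on `Y`, possibly infinite. -/
def c2Norm (f : ℝ × ℝ → ℝ) (Y : Set (ℝ × ℝ)) : ENNReal :=
  c0Norm f Y ⊔ c1Norm (du f) Y ⊔ c1Norm (dv f) Y

/-! ### Causal structure of the plane with the metric `-du dv`

Both null coordinates increase towards the future, so `q` is in the causal past of `p` exactly
when `q ≤ p` in the product order of `ℝ × ℝ`. -/

/-- `J⁻(p)`. -/
def causalPast (p : ℝ × ℝ) : Set (ℝ × ℝ) := Iic p

/-- `J⁻(X)`. -/
def causalPastSet (X : Set (ℝ × ℝ)) : Set (ℝ × ℝ) := ⋃ x ∈ X, causalPast x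

/-- `c`, restricted to `[0, ∞)`, is a past-directed causal curve that starts at `q` and has no
past endpoint. -/
structure IsPastInextendible (c : ℝ → ℝ × ℝ) (q : ℝ × ℝ) : Prop where
  start : c 0 = q
  continuousOn : ContinuousOn c (Ici 0)
  causal : AntitoneOn c (Ici 0)
  no_endpoint : ¬ ∃ z, Tendsto c atTop (𝓝 z)

/-- The future domain of dependence `D⁺(X)`. -/
def domainOfDependence (X : Set (ℝ × ℝ)) : Set (ℝ × ℝ) :=
  {q | ∀ c, IsPastInextendible c q → ∃ t, 0 ≤ t ∧ c t ∈ X}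

/-- The union of the two null segments
`{u_s - ε} × [v_s - ε, v_s]` and `[u_s - ε, u_s] × {v_s - ε}`, for `p = (u_s, v_s)`. -/
def nullCorner (p : ℝ × ℝ) (ε : ℝ) : Set (ℝ × ℝ) :=
  ({p.1 - ε} ×ˢ Icc (p.2 - ε) p.2) ∪ (Icc (p.1 - ε) p.1 ×ˢ {p.2 - ε})

/-! ### The space-times -/

/-- A solution of the Einstein equations `R_{μν} - (1/2) g_{μν} R = 2 T_{μν}` in dimension
`n + 2` with metric `-Ω² du dv + r² γ`, where `γ` is an Einstein metric with constant `k`, for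
matter that respects the transverse symmetry and satisfies the energy conditions with
constant `C`. The transverse metric is given in one coordinate chart `V`.

`ContDiffAt` at a point of `S` expresses regularity up to the boundary curve `S`. -/
structure SymmetricSpacetime (n : ℕ) (k C : ℝ) where
  /-- the quotient region -/
  Q : Set (ℝ × ℝ)
  /-- the initial curve -/
  S : Set (ℝ × ℝ)
  /-- the centre -/
  Γ : Set (ℝ × ℝ)
  /-- the radius function -/
  r : ℝ × ℝ → ℝ
  /-- the conformal factor -/
  Ω : ℝ × ℝ → ℝ
  /-- the transverse chart -/
  V : Set (Fin n → ℝ)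
  /-- the transverse metric -/
  γ : (Fin n → ℝ) → Matrix (Fin n) (Fin n) ℝ
  /-- the component `T_uu` of the stress tensor -/
  Tuu : ℝ × ℝ → ℝ
  /-- the component `T_uv` of the stress tensor -/
  Tuv : ℝ × ℝ → ℝ
  /-- the component `T_vv` of the stress tensor -/
  Tvv : ℝ × ℝ → ℝ
  /-- the factor in `T_ij = P γ_ij` -/
  P : ℝ × ℝ → ℝ
  -- The boundary of the region consists of the spacelike curve `S`, on its past side, and the
  -- timelike curve `Γ`, which meet in a single point.
  S_subset : S ⊆ Q
  Γ_subset : Γ ⊆ Q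
  interior_eq : interior Q = Q \ (S ∪ Γ)
  S_connected : IsConnected S
  S_spacelike : ∀ a ∈ S, ∀ b ∈ S, a ≠ b →
    (a.1 < b.1 ∧ b.2 < a.2) ∨ (b.1 < a.1 ∧ a.2 < b.2)
  S_past : ∀ a ∈ S, ∀ q ∈ Q, q ∈ causalPast a → q = a
  Γ_connected : IsConnected Γ
  Γ_timelike : ∀ a ∈ Γ, ∀ b ∈ Γ, a ≠ b →
    (a.1 < b.1 ∧ a.2 < b.2) ∨ (b.1 < a.1 ∧ b.2 < a.2)
  S_inter_Γ : ∃ o, S ∩ Γ = {o}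
  -- The centre is the zero set of the radius.
  r_zero : ∀ q ∈ Γ, r q = 0
  r_pos : ∀ q ∈ Q \ Γ, 0 < r q
  r_continuous : ContinuousOn r Q
  Ω_pos : ∀ q ∈ Q \ Γ, 0 < Ω q
  -- Regularity: `r` is `C²`, `Ω` is `C¹`, and `Ω` has the mixed second derivatives that occur in
  -- the Ricci tensor.
  r_regular : ∀ q ∈ Q \ Γ, ContDiffAt ℝ 2 r q
  Ω_regular : ∀ q ∈ Q \ Γ, ContDiffAt ℝ 1 Ω q
  Ω_mixed : ∀ q ∈ interior Q, DifferentiableAt ℝ (fun v => du Ω (q.1, v)) q.2 ∧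
    DifferentiableAt ℝ (fun u => dv Ω (u, q.2)) q.1
  -- Evolution from initial data: null curves of constant `u` start, in the past, on `S` or on the
  -- centre; null curves of constant `v` start on `S` or at infinity, and `∂r/∂u` is negative
  -- on `S` and at infinity.
  constU_past : ∀ q ∈ Q, ∃ b ≤ q.2, (q.1, b) ∈ S ∪ Γ ∧ ∀ v ∈ Icc b q.2, (q.1, v) ∈ Q
  constV_past : ∀ q ∈ Q \ Γ,
    (∃ a ≤ q.1, (a, q.2) ∈ S ∧ ∀ u ∈ Icc a q.1, (u, q.2) ∈ Q \ Γ) ∨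
    (∃ a < q.1, (∀ u ∈ Ioc a q.1, (u, q.2) ∈ Q \ Γ) ∧
      Tendsto (fun u => r (u, q.2)) (𝓝[>] a) atTop ∧
      ∀ᶠ u in 𝓝[>] a, du r (u, q.2) < 0)
  nu_neg_S : ∀ q ∈ S \ Γ, du r q < 0
  -- The transverse metric is Riemannian, with `R_ij = k (n - 1) γ_ij`.
  V_open : IsOpen V
  V_nonempty : V.Nonempty
  γ_regular : ∀ i j, ContDiffOn ℝ 2 (fun y => γ y i j) V
  γ_posDef : ∀ y ∈ V, (γ y).PosDef
  γ_einstein : ∀ y ∈ V, ∀ i j, ricci γ i j y = k * ((n : ℝ) - 1) * γ y i j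
  -- The matter is continuous and satisfies the energy conditions.
  Tuu_continuous : ContinuousOn Tuu (Q \ Γ)
  Tuv_continuous : ContinuousOn Tuv (Q \ Γ)
  Tvv_continuous : ContinuousOn Tvv (Q \ Γ)
  P_continuous : ContinuousOn P (Q \ Γ)
  Tuu_nonneg : ∀ q ∈ Q \ Γ, 0 ≤ Tuu q
  Tvv_nonneg : ∀ q ∈ Q \ Γ, 0 ≤ Tvv q
  Tuv_ge : ∀ q ∈ Q \ Γ, -|2 * metricUV Ω q| * C ≤ Tuv q
  -- The Einstein equations.
  einstein : ∀ x : Fin 2 ⊕ Fin n → ℝ, base x ∈ interior Q → fibre x ∈ V → ∀ μ ν,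
    einsteinTensor (spacetimeMetric Ω r γ) μ ν x = 2 * stressTensor Tuu Tuv Tvv P γ x μ ν

namespace SymmetricSpacetime

variable {n : ℕ} {k C : ℝ} (M : SymmetricSpacetime n k C)

/-- `ν = ∂r/∂u`. -/
def nu : ℝ × ℝ → ℝ := du M.r

/-- `λ = ∂r/∂v`. -/
def lam : ℝ × ℝ → ℝ := dv M.r

/-- The mass function `m = (r^(n-1) / 2) (k + 4 ν λ / Ω²)`. -/
def mass (q : ℝ × ℝ) : ℝ :=
  (M.r q) ^ (n - 1) / 2 * (k + 4 * M.nu q * M.lam q / (M.Ω q) ^ 2)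

/-- The trapped region. -/
def trapped : Set (ℝ × ℝ) := {q ∈ M.Q | M.lam q < 0}

/-- `X` is a compact subset of `Q`, and `J⁻(p) ∩ Q` together with its endpoint `p` is contained in
the union of `D⁺(X)` and of the past of `X` in `Q`. -/
def Generates (X : Set (ℝ × ℝ)) (p : ℝ × ℝ) : Prop :=
  IsCompact X ∧ X ⊆ M.Q ∧
    insert p (causalPast p ∩ M.Q) ⊆ domainOfDependence X ∪ (causalPastSet X ∩ M.Q)

/-- The indecomposable past set `J⁻(p) ∩ Q` is eventually compactly generated. -/
def EventuallyCompactlyGenerated (p : ℝ × ℝ) : Prop := ∃ X, M.Generates X p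

/-- First singularities: boundary points `p` outside `Q` such that `J⁻(p) ∩ Q` is eventually
compactly generated and every eventually compactly generated indecomposable past set that is a
proper subset of `J⁻(p) ∩ Q` is the past in `Q` of a point of `Q`. -/
structure IsFirstSingularity (p : ℝ × ℝ) : Prop where
  mem_closure : p ∈ closure M.Q
  notMem : p ∉ M.Q
  generated : M.EventuallyCompactlyGenerated p
  first : ∀ q ∈ closure M.Q, M.EventuallyCompactlyGenerated q →
    causalPast q ∩ M.Q ⊂ causalPast p ∩ M.Q →
    ∃ z ∈ M.Q, causalPast q ∩ M.Q = causalPast z ∩ M.Q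

/-- `N(Y) = sup {|Ω|₁, |Ω⁻¹|₀, |r|₂, |r⁻¹|₁}`. -/
def extensionNorm (Y : Set (ℝ × ℝ)) : ENNReal :=
  c1Norm M.Ω Y ⊔ c0Norm (fun q => (M.Ω q)⁻¹) Y ⊔ c2Norm M.r Y ⊔ c1Norm (fun q => (M.r q)⁻¹) Y

/-- The extension criterion: near a first singularity away from the closure of the centre, the norm
`N` is infinite. -/
def ExtensionCriterion : Prop :=
  ∀ p, M.IsFirstSingularity p → p ∉ closure M.Γ →
    ∀ X, X ⊆ M.Q \ M.Γ → M.Generates X p →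
      M.extensionNorm ((domainOfDependence X \ {p}) ∩ (M.Q \ M.Γ)) = ⊤

/-- The punctured past neighbourhood `D⁺(X) \ {p}`, with `X` the null corner of size `ε` at `p`. -/
def pastNhd (p : ℝ × ℝ) (ε : ℝ) : Set (ℝ × ℝ) := domainOfDependence (nullCorner p ε) \ {p}

/-- The punctured past neighbourhood of size `ε` lies in `Q`, off the initial curve and the
centre. -/
def Admissible (p : ℝ × ℝ) (ε : ℝ) : Prop :=
  0 < ε ∧ pastNhd p ε ⊆ M.Q \ (M.S ∪ M.Γ)

end SymmetricSpacetime

end Collapse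

end

open Set Filter Topology

noncomputable section

namespace Collapse

/-! ### Partial derivatives of functions with separated variables -/

section PartialDerivatives

variable {n : ℕ}

/-! Close to `p` the region contains a characteristic rectangle minus its top corner `p`. Its two
past edges form a compact set off the centre, so continuous quantities built from `r`, `Ω`, `ν`, `λ`
are bounded there, and monotonicity along null lines carries these bounds inside.

The null-null Einstein equations make `ν/Ω²` nonincreasing in `u` and `λ/Ω²` nonincreasing in `v`
(`nullD_div_sq`); the mixed one is a wave equation for `r` (`mul_dv_nu`); together they give both
derivatives of the mass. Hence `ν < 0` and `Ω² ≤ K|ν|`. If `λ ≥ 0`, then `r` lies between edge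
values, and `m + c r^(n+1)` is monotone in both null directions once `c` absorbs the negativity
allowed for `T_uv`. So `m`, then `νλ/Ω²`, then `λ` are bounded, and the wave equation becomes a
linear inequality for `ν` along `v`, which bounds `ν` and with it `Ω`.

The lower bound on `|ν|` needs more, since `T_uv` has no pointwise upper bound. Where `λ ≥ λ₀`,
however, `∂_v m` dominates a multiple of `(T_uv + CΩ²)/|ν|`, which is the bad term in `∂_v log|ν|`.
Adding multiples of `m` and `v` to `log|ν|` gives a function increasing in `v`
(`exists_nu_lower_bound`). The same flux dominates every matter component, whence integrability
(`exists_stress_le`). Everything in the extension norm is then bounded, apart from first derivatives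
of `Ω`, `λ`, `ν`.

That the rectangle exists is a causal argument. Minimality of a first singularity puts suitable
limit points back into `Q` (`mem_of_mem_closure`), so a point of `Q` close to `p` in its past yields
the whole diamond up to `p` (`Icc_subset`). Such points exist (`exists_mem_past`): otherwise a null
line `v = const` would run to infinity next to a boundary point, where `r` is bounded, or violate
the position of `S`. -/

/-- The derivative in the null direction `a`: `∂/∂u` for `a = 0` and `∂/∂v` for `a = 1`. -/
def nullD (a : Fin 2) (F : ℝ × ℝ → ℝ) (q : ℝ × ℝ) : ℝ := if a = 0 then du F q else dv F q

theorem partialD_congr {ι : Type*} [DecidableEq ι] [Fintype ι] {i : ι} {f g : (ι → ℝ) → ℝ} {x : ι → ℝ}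
    (h : f =ᶠ[𝓝 x] g) : partialD i f x = partialD i g x :=
  h.lineDeriv_eq

@[simp] theorem partialD_const {ι : Type*} [DecidableEq ι] (i : ι) (c : ℝ) (x : ι → ℝ) :
    partialD i (fun _ => c) x = 0 := by
  simp [partialD, lineDeriv]

/-- Metric and connection components are products of a function of `(u, v)` and one of the fibre
coordinates. On a coordinate line one factor is constant and leaves the derivative unconditionally,
so no differentiability is needed. -/
theorem partialD_inl_mul (a : Fin 2) (F : ℝ × ℝ → ℝ) (H : (Fin n → ℝ) → ℝ)
    (x : Fin 2 ⊕ Fin n → ℝ) :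
    partialD (Sum.inl a) (fun y => F (base y) * H (fibre y)) x
      = nullD a F (base x) * H (fibre x) := by
  have hfib : ∀ t : ℝ, fibre (x + t • Pi.single (Sum.inl a) 1) = fibre x := by
    intro t; ext i; simp [fibre]
  fin_cases a
  · have hb : ∀ t : ℝ, base (x + t • Pi.single (Sum.inl 0) 1)
        = ((base x).1 + t, (base x).2) := by
      intro t; simp [base]
    simp only [Fin.zero_eta, Fin.isValue] at hfib ⊢
    simp only [partialD, lineDeriv, hfib, hb, deriv_mul_const_field, nullD, if_true, du]
    rw [deriv_comp_const_add (fun u => F (u, (base x).2))]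
    simp
  · have hb : ∀ t : ℝ, base (x + t • Pi.single (Sum.inl 1) 1)
        = ((base x).1, (base x).2 + t) := by
      intro t; simp [base]
    simp only [Fin.mk_one, Fin.isValue] at hfib ⊢
    simp only [partialD, lineDeriv, hfib, hb, deriv_mul_const_field, nullD, dv]
    rw [deriv_comp_const_add (fun v => F ((base x).1, v))]
    simp

theorem partialD_inr_mul (i : Fin n) (F : ℝ × ℝ → ℝ) (H : (Fin n → ℝ) → ℝ)
    (x : Fin 2 ⊕ Fin n → ℝ) :
    partialD (Sum.inr i) (fun y => F (base y) * H (fibre y)) x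
      = F (base x) * partialD i H (fibre x) := by
  have hb : ∀ t : ℝ, base (x + t • Pi.single (Sum.inr i) 1) = base x := by
    intro t; simp [base]
  have hfib : ∀ t : ℝ, fibre (x + t • Pi.single (Sum.inr i) 1)
      = fibre x + t • Pi.single i 1 := by
    intro t; ext j; simp [fibre, Pi.single_apply]
  simp only [partialD, lineDeriv, hfib, hb, deriv_const_mul_field]

@[simp] theorem partialD_inl_base (a : Fin 2) (F : ℝ × ℝ → ℝ) (x : Fin 2 ⊕ Fin n → ℝ) :
    partialD (Sum.inl a) (fun y => F (base y)) x = nullD a F (base x) := by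
  simpa using partialD_inl_mul a F (fun _ => 1) x

@[simp] theorem partialD_inr_base (i : Fin n) (F : ℝ × ℝ → ℝ) (x : Fin 2 ⊕ Fin n → ℝ) :
    partialD (Sum.inr i) (fun y => F (base y)) x = 0 := by
  simpa using partialD_inr_mul i F (fun _ => 1) x

@[simp] theorem partialD_inr_fibre (i : Fin n) (H : (Fin n → ℝ) → ℝ) (x : Fin 2 ⊕ Fin n → ℝ) :
    partialD (Sum.inr i) (fun y => H (fibre y)) x = partialD i H (fibre x) := by
  simpa using partialD_inr_mul i (fun _ => 1) H x

theorem continuous_base : Continuous (base : (Fin 2 ⊕ Fin n → ℝ) → ℝ × ℝ) := by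
  unfold base; fun_prop

theorem continuous_fibre : Continuous (fibre : (Fin 2 ⊕ Fin n → ℝ) → Fin n → ℝ) := by
  unfold fibre; fun_prop

end PartialDerivatives

/-! ### Curvature of the metric `-Ω² du dv + r² γ` -/

section Warped

variable {n : ℕ} {Ω r : ℝ × ℝ → ℝ} {γ : (Fin n → ℝ) → Matrix (Fin n) (Fin n) ℝ}
  {x : Fin 2 ⊕ Fin n → ℝ}

/-- At `x` the metric is nondegenerate and `r` is differentiable. -/
structure IsNondegenerateAt (Ω r : ℝ × ℝ → ℝ) (γ : (Fin n → ℝ) → Matrix (Fin n) (Fin n) ℝ)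
    (x : Fin 2 ⊕ Fin n → ℝ) : Prop where
  Ω_ne : Ω (base x) ≠ 0
  r_ne : r (base x) ≠ 0
  isUnit_det : IsUnit (γ (fibre x)).det
  differentiableAt : DifferentiableAt ℝ r (base x)

@[simp] theorem spacetimeMetric_inl_inl (a b : Fin 2) :
    spacetimeMetric Ω r γ x (Sum.inl a) (Sum.inl b)
      = if a = b then 0 else metricUV Ω (base x) := by
  fin_cases a <;> fin_cases b <;> simp [spacetimeMetric]

@[simp] theorem spacetimeMetric_inl_inr (a : Fin 2) (j : Fin n) :
    spacetimeMetric Ω r γ x (Sum.inl a) (Sum.inr j) = 0 := by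
  simp [spacetimeMetric]

@[simp] theorem spacetimeMetric_inr_inl (a : Fin 2) (j : Fin n) :
    spacetimeMetric Ω r γ x (Sum.inr j) (Sum.inl a) = 0 := by
  simp [spacetimeMetric]

@[simp] theorem spacetimeMetric_inr_inr (i j : Fin n) :
    spacetimeMetric Ω r γ x (Sum.inr i) (Sum.inr j) = r (base x) ^ 2 * γ (fibre x) i j := by
  simp [spacetimeMetric]

theorem spacetimeMetric_inv (h : IsNondegenerateAt Ω r γ x) :
    (spacetimeMetric Ω r γ x)⁻¹ =
      Matrix.fromBlocks !![0, (metricUV Ω (base x))⁻¹; (metricUV Ω (base x))⁻¹, 0] 0 0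
        ((r (base x) ^ 2)⁻¹ • (γ (fibre x))⁻¹) := by
  obtain ⟨hΩ, hr, hγ, -⟩ := h
  have hf : metricUV Ω (base x) ≠ 0 := by simp [metricUV, hΩ]
  apply Matrix.inv_eq_right_inv
  rw [spacetimeMetric, Matrix.fromBlocks_multiply, ← Matrix.fromBlocks_one]
  congr 1
  · ext i j; fin_cases i <;> fin_cases j <;> simp [hf]
  · simp
  · simp
  · rw [Matrix.smul_mul, Matrix.mul_smul, Matrix.mul_nonsing_inv _ hγ, smul_smul,
      mul_inv_cancel₀ (pow_ne_zero 2 hr), one_smul]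
    simp

/-- The null block of the inverse metric is off-diagonal, so only the index `1 - a` survives the
contraction; subtraction in `Fin 2` swaps `u` and `v`. -/
theorem christoffel_inl_sum (h : IsNondegenerateAt Ω r γ x) (a : Fin 2) (b c : Fin 2 ⊕ Fin n) :
    christoffel (spacetimeMetric Ω r γ) (Sum.inl a) b c x =
      (1 / 2) * ((metricUV Ω (base x))⁻¹ *
      (partialD b (fun y => spacetimeMetric Ω r γ y (Sum.inl (1 - a)) c) x
        + partialD c (fun y => spacetimeMetric Ω r γ y (Sum.inl (1 - a)) b) x
        - partialD (Sum.inl (1 - a)) (fun y => spacetimeMetric Ω r γ y b c) x)) := by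
  rw [christoffel, spacetimeMetric_inv h, Fintype.sum_sum_type, Fin.sum_univ_two]
  fin_cases a <;> simp

theorem christoffel_inr_sum (h : IsNondegenerateAt Ω r γ x) (i : Fin n) (b c : Fin 2 ⊕ Fin n) :
    christoffel (spacetimeMetric Ω r γ) (Sum.inr i) b c x =
      (1 / 2) * ∑ d, (r (base x) ^ 2)⁻¹ * (γ (fibre x))⁻¹ i d *
      (partialD b (fun y => spacetimeMetric Ω r γ y (Sum.inr d) c) x
        + partialD c (fun y => spacetimeMetric Ω r γ y (Sum.inr d) b) x
        - partialD (Sum.inr d) (fun y => spacetimeMetric Ω r γ y b c) x) := by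
  rw [christoffel, spacetimeMetric_inv h, Fintype.sum_sum_type, Fin.sum_univ_two]
  simp

theorem christoffel_base (h : IsNondegenerateAt Ω r γ x) (a b c : Fin 2) :
    christoffel (spacetimeMetric Ω r γ) (Sum.inl a) (Sum.inl b) (Sum.inl c) x =
      if a = b ∧ a = c then nullD a (metricUV Ω) (base x) / metricUV Ω (base x) else 0 := by
  rw [christoffel_inl_sum h]
  fin_cases a <;> fin_cases b <;> fin_cases c <;> simp <;> ring

theorem christoffel_inl_inl_inr (h : IsNondegenerateAt Ω r γ x) (a b : Fin 2) (j : Fin n) :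
    christoffel (spacetimeMetric Ω r γ) (Sum.inl a) (Sum.inl b) (Sum.inr j) x = 0 := by
  rw [christoffel_inl_sum h]
  fin_cases a <;> fin_cases b <;> simp

theorem christoffel_inl_inr_inl (h : IsNondegenerateAt Ω r γ x) (a b : Fin 2) (j : Fin n) :
    christoffel (spacetimeMetric Ω r γ) (Sum.inl a) (Sum.inr j) (Sum.inl b) x = 0 := by
  rw [christoffel_inl_sum h]
  fin_cases a <;> fin_cases b <;> simp

theorem christoffel_inr_inl_inl (h : IsNondegenerateAt Ω r γ x) (a b : Fin 2) (i : Fin n) :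
    christoffel (spacetimeMetric Ω r γ) (Sum.inr i) (Sum.inl a) (Sum.inl b) x = 0 := by
  rw [christoffel_inr_sum h]
  fin_cases a <;> fin_cases b <;> simp

theorem nullD_sq (hd : DifferentiableAt ℝ r (base x)) (a : Fin 2) :
    nullD a (fun q => r q ^ 2) (base x) = 2 * r (base x) * nullD a r (base x) := by
  have h1 : DifferentiableAt ℝ (fun u => r (u, (base x).2)) (base x).1 :=
    DifferentiableAt.comp (f := fun u => (u, (base x).2)) _ hd (by fun_prop)
  have h2 : DifferentiableAt ℝ (fun v => r ((base x).1, v)) (base x).2 :=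
    DifferentiableAt.comp (f := fun v => ((base x).1, v)) _ hd (by fun_prop)
  fin_cases a
  · simpa [nullD, du] using (h1.hasDerivAt.fun_pow 2).deriv
  · simpa [nullD, dv] using (h2.hasDerivAt.fun_pow 2).deriv

theorem christoffel_inl_inr_inr (h : IsNondegenerateAt Ω r γ x)
    (a : Fin 2) (i j : Fin n) :
    christoffel (spacetimeMetric Ω r γ) (Sum.inl a) (Sum.inr i) (Sum.inr j) x =
      -(r (base x) * nullD (1 - a) r (base x) / metricUV Ω (base x)) * γ (fibre x) i j := by
  rw [christoffel_inl_sum h]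
  simp only [spacetimeMetric_inl_inr, spacetimeMetric_inr_inr, partialD_const,
    partialD_inl_mul (1 - a) (fun q => r q ^ 2) (fun z => γ z i j), nullD_sq h.differentiableAt]
  ring

theorem christoffel_inr_inl_inr (h : IsNondegenerateAt Ω r γ x)
    (a : Fin 2) (i j : Fin n) :
    christoffel (spacetimeMetric Ω r γ) (Sum.inr i) (Sum.inl a) (Sum.inr j) x =
      if i = j then nullD a r (base x) / r (base x) else 0 := by
  rw [christoffel_inr_sum h]
  simp only [spacetimeMetric_inr_inl, spacetimeMetric_inl_inr, spacetimeMetric_inr_inr,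
    partialD_const, fun d => partialD_inl_mul a (fun q => r q ^ 2) (fun z => γ z d j) x,
    nullD_sq h.differentiableAt, add_zero, sub_zero]
  have hr := h.r_ne
  have h1 := congrFun (congrFun (Matrix.nonsing_inv_mul _ h.isUnit_det) i) j
  rw [Matrix.mul_apply, Matrix.one_apply] at h1
  have : ∀ d, (r (base x) ^ 2)⁻¹ * (γ (fibre x))⁻¹ i d *
      (2 * r (base x) * nullD a r (base x) * γ (fibre x) d j)
      = (2 * nullD a r (base x) / r (base x)) * ((γ (fibre x))⁻¹ i d * γ (fibre x) d j) := by
    intro d; field_simp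
  simp only [this, ← Finset.mul_sum, h1]
  split_ifs <;> ring

theorem christoffel_inr_inr_inl (h : IsNondegenerateAt Ω r γ x)
    (a : Fin 2) (i j : Fin n) :
    christoffel (spacetimeMetric Ω r γ) (Sum.inr i) (Sum.inr j) (Sum.inl a) x =
      if i = j then nullD a r (base x) / r (base x) else 0 := by
  rw [← christoffel_inr_inl_inr h, christoffel_inr_sum h,
    christoffel_inr_sum h]
  congr 1
  refine Finset.sum_congr rfl fun d _ => ?_
  simp only [spacetimeMetric_inr_inl, spacetimeMetric_inl_inr, partialD_const]
  ring

theorem christoffel_fibre (h : IsNondegenerateAt Ω r γ x) (i j l : Fin n) :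
    christoffel (spacetimeMetric Ω r γ) (Sum.inr i) (Sum.inr j) (Sum.inr l) x =
      christoffel γ i j l (fibre x) := by
  rw [christoffel_inr_sum h, christoffel]
  congr 1
  refine Finset.sum_congr rfl fun d _ => ?_
  simp only [spacetimeMetric_inr_inr,
    fun (m s t : Fin n) => partialD_inr_mul m (fun q => r q ^ 2) (fun z => γ z s t) x]
  have hr := h.r_ne
  field_simp

/-- The derivatives of `Γ^a_{aa}` cancel between the first two terms of the Ricci tensor. What
remains is `n` equal contributions of the fibre directions, with only first derivatives of `Ω`. -/
theorem ricci_null (h : ∀ᶠ y in 𝓝 x, IsNondegenerateAt Ω r γ y) (a : Fin 2) :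
    ricci (spacetimeMetric Ω r γ) (Sum.inl a) (Sum.inl a) x =
      n * (nullD a (metricUV Ω) (base x) / metricUV Ω (base x) * (nullD a r (base x) / r (base x))
        - nullD a (fun q => nullD a r q / r q) (base x) - (nullD a r (base x) / r (base x)) ^ 2) := by
  have hx := h.self_of_nhds
  have e1 : ∀ i : Fin n, partialD (Sum.inr i)
      (christoffel (spacetimeMetric Ω r γ) (Sum.inr i) (Sum.inl a) (Sum.inl a)) x = 0 :=
    fun i => (partialD_congr (h.mono fun y hy => christoffel_inr_inl_inl hy a a i)).trans
      (partialD_const _ _ _)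
  have e2 : ∀ i : Fin n, partialD (Sum.inl a)
      (christoffel (spacetimeMetric Ω r γ) (Sum.inr i) (Sum.inl a) (Sum.inr i)) x
        = nullD a (fun q => nullD a r q / r q) (base x) := fun i =>
    (partialD_congr (h.mono fun y hy => by
      rw [christoffel_inr_inl_inr hy, if_pos rfl])).trans
        (partialD_inl_base a (fun q => nullD a r q / r q) x)
  have e3 : ∀ b c d : Fin 2, a ≠ b → partialD (Sum.inl d)
      (christoffel (spacetimeMetric Ω r γ) (Sum.inl b) (Sum.inl a) (Sum.inl c)) x = 0 :=
    fun b c d hab => (partialD_congr (h.mono fun y hy => by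
      rw [christoffel_base hy, if_neg (fun e => hab e.1.symm)])).trans (partialD_const _ _ _)
  simp only [ricci, Fintype.sum_sum_type, e1, e2, christoffel_base hx,
    christoffel_inl_inl_inr hx, christoffel_inr_inl_inl hx,
    christoffel_inr_inl_inr hx, christoffel_inr_inr_inl hx]
  obtain rfl | rfl : a = 0 ∨ a = 1 := by fin_cases a <;> simp
  · simp [e3 1 _ _ (by simp)]
    ring
  · simp [e3 0 _ _ (by simp)]
    ring

/-- The factor `n - 2` is the trace `Γ^l_{la}`, worth `n`, less the two contractions `Γ^a_{jl}
Γ^l_{ia}` and `Γ^l_{ja} Γ^a_{il}`; symmetry of `γ` makes these two equal. -/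
theorem ricci_fibre (h : ∀ᶠ y in 𝓝 x, IsNondegenerateAt Ω r γ y)
    (hγ : (γ (fibre x)).IsSymm) (i j : Fin n) :
    ricci (spacetimeMetric Ω r γ) (Sum.inr i) (Sum.inr j) x = ricci γ i j (fibre x) +
      γ (fibre x) i j * ∑ a : Fin 2,
        (-nullD a (fun q => r q * nullD (1 - a) r q / metricUV Ω q) (base x)
          - (nullD a (metricUV Ω) (base x) / metricUV Ω (base x)
            + (n - 2) * nullD a r (base x) / r (base x))
            * (r (base x) * nullD (1 - a) r (base x) / metricUV Ω (base x))) := by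
  have hx := h.self_of_nhds
  have e1 : ∀ a : Fin 2, partialD (Sum.inl a)
      (christoffel (spacetimeMetric Ω r γ) (Sum.inl a) (Sum.inr i) (Sum.inr j)) x
        = -nullD a (fun q => r q * nullD (1 - a) r q / metricUV Ω q) (base x)
          * γ (fibre x) i j := by
    intro a
    refine (partialD_congr (h.mono fun y hy => christoffel_inl_inr_inr hy a i j)).trans ?_
    rw [partialD_inl_mul a (fun q => -(r q * nullD (1 - a) r q / metricUV Ω q))
      (fun z => γ z i j)]
    congr 1
    unfold nullD du dv
    split_ifs <;> exact deriv.fun_neg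
  have e2 : ∀ l s t m : Fin n, partialD (Sum.inr m)
      (christoffel (spacetimeMetric Ω r γ) (Sum.inr l) (Sum.inr s) (Sum.inr t)) x
        = partialD m (christoffel γ l s t) (fibre x) := fun l s t m =>
    (partialD_congr (h.mono fun y hy => christoffel_fibre hy l s t)).trans
      (partialD_inr_fibre m (christoffel γ l s t) x)
  have e3 : ∀ a : Fin 2, partialD (Sum.inr j)
      (christoffel (spacetimeMetric Ω r γ) (Sum.inl a) (Sum.inr i) (Sum.inl a)) x = 0 :=
    fun a => (partialD_congr (h.mono fun y hy => christoffel_inl_inr_inl hy a a i)).trans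
      (partialD_const _ _ _)
  have hs : γ (fibre x) j i = γ (fibre x) i j := hγ.apply i j
  simp only [ricci, Fintype.sum_sum_type, e1, e2, e3, christoffel_base hx,
    christoffel_inl_inl_inr hx, christoffel_inl_inr_inl hx,
    christoffel_inr_inr_inl hx, christoffel_inl_inr_inr hx,
    christoffel_fibre hx, Fin.sum_univ_two]
  simp [Finset.sum_add_distrib, hs]
  ring

end Warped

/-! ### Calculus of the null derivatives -/

section NullDerivatives

variable {F G : ℝ × ℝ → ℝ} {q : ℝ × ℝ}

theorem differentiableAt_u (hF : DifferentiableAt ℝ F q) :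
    DifferentiableAt ℝ (fun u => F (u, q.2)) q.1 :=
  DifferentiableAt.comp (f := fun u => (u, q.2)) _ hF (by fun_prop)

theorem differentiableAt_v (hF : DifferentiableAt ℝ F q) :
    DifferentiableAt ℝ (fun v => F (q.1, v)) q.2 :=
  DifferentiableAt.comp (f := fun v => (q.1, v)) _ hF (by fun_prop)

theorem hasDerivAt_du (hF : DifferentiableAt ℝ F q) :
    HasDerivAt (fun u => F (u, q.2)) (du F q) q.1 :=
  (differentiableAt_u hF).hasDerivAt

theorem hasDerivAt_dv (hF : DifferentiableAt ℝ F q) :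
    HasDerivAt (fun v => F (q.1, v)) (dv F q) q.2 :=
  (differentiableAt_v hF).hasDerivAt

theorem nullD_mul (a : Fin 2) (hF : DifferentiableAt ℝ F q) (hG : DifferentiableAt ℝ G q) :
    nullD a (fun z => F z * G z) q = nullD a F q * G q + F q * nullD a G q := by
  unfold nullD
  split_ifs
  · exact ((hasDerivAt_du hF).fun_mul (hasDerivAt_du hG)).deriv
  · exact ((hasDerivAt_dv hF).fun_mul (hasDerivAt_dv hG)).deriv

theorem nullD_div (a : Fin 2) (hF : DifferentiableAt ℝ F q) (hG : DifferentiableAt ℝ G q)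
    (h0 : G q ≠ 0) :
    nullD a (fun z => F z / G z) q = (nullD a F q * G q - F q * nullD a G q) / G q ^ 2 := by
  unfold nullD
  split_ifs
  · exact ((hasDerivAt_du hF).fun_div (hasDerivAt_du hG) h0).deriv
  · exact ((hasDerivAt_dv hF).fun_div (hasDerivAt_dv hG) h0).deriv

theorem nullD_metricUV (a : Fin 2) (hF : DifferentiableAt ℝ F q) :
    nullD a (metricUV F) q = -(F q * nullD a F q) := by
  have e : metricUV F = fun z => F z * (-F z / 2) := by
    ext z; simp only [metricUV]; ring
  have h1 : nullD a (fun z => -F z / 2) q = -nullD a F q / 2 := by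
    unfold nullD
    split_ifs
    · exact ((hasDerivAt_du hF).fun_neg.div_const 2).deriv
    · exact ((hasDerivAt_dv hF).fun_neg.div_const 2).deriv
  rw [e, nullD_mul a hF (by fun_prop), h1]
  ring

theorem du_eq_fderiv (hF : DifferentiableAt ℝ F q) : du F q = fderiv ℝ F q (1, 0) := by
  have h : HasDerivAt (fun u : ℝ => ((u, q.2) : ℝ × ℝ)) (1, 0) q.1 :=
    (hasDerivAt_id q.1).prodMk (hasDerivAt_const q.1 q.2)
  exact (HasFDerivAt.comp_hasDerivAt q.1 (f := fun u : ℝ => ((u, q.2) : ℝ × ℝ))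
    hF.hasFDerivAt h).deriv

theorem dv_eq_fderiv (hF : DifferentiableAt ℝ F q) : dv F q = fderiv ℝ F q (0, 1) := by
  have h : HasDerivAt (fun v : ℝ => ((q.1, v) : ℝ × ℝ)) (0, 1) q.2 :=
    (hasDerivAt_const q.2 q.1).prodMk (hasDerivAt_id q.2)
  exact (HasFDerivAt.comp_hasDerivAt q.2 (f := fun v : ℝ => ((q.1, v) : ℝ × ℝ))
    hF.hasFDerivAt h).deriv

theorem eventually_du_eq (hF : ContDiffAt ℝ 2 F q) :
    du F =ᶠ[𝓝 q] fun z => fderiv ℝ F z (1, 0) := by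
  filter_upwards [hF.eventually (by simp)] with z hz
  exact du_eq_fderiv (hz.differentiableAt (by simp))

theorem eventually_dv_eq (hF : ContDiffAt ℝ 2 F q) :
    dv F =ᶠ[𝓝 q] fun z => fderiv ℝ F z (0, 1) := by
  filter_upwards [hF.eventually (by simp)] with z hz
  exact dv_eq_fderiv (hz.differentiableAt (by simp))

theorem contDiffAt_du (hF : ContDiffAt ℝ 2 F q) : ContDiffAt ℝ 1 (du F) q :=
  ((hF.fderiv_right (m := 1) (by norm_num)).clm_apply contDiffAt_const).congr_of_eventuallyEq
    (eventually_du_eq hF)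

theorem contDiffAt_dv (hF : ContDiffAt ℝ 2 F q) : ContDiffAt ℝ 1 (dv F) q :=
  ((hF.fderiv_right (m := 1) (by norm_num)).clm_apply contDiffAt_const).congr_of_eventuallyEq
    (eventually_dv_eq hF)

theorem du_dv_comm (hF : ContDiffAt ℝ 2 F q) : du (dv F) q = dv (du F) q := by
  have hd : DifferentiableAt ℝ (fderiv ℝ F) q :=
    (hF.fderiv_right (m := 1) (by norm_num)).differentiableAt (by simp)
  rw [du_eq_fderiv ((contDiffAt_dv hF).differentiableAt (by simp)),
    dv_eq_fderiv ((contDiffAt_du hF).differentiableAt (by simp)),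
    (eventually_du_eq hF).fderiv_eq, (eventually_dv_eq hF).fderiv_eq,
    fderiv_clm_apply hd (by fun_prop), fderiv_clm_apply hd (by fun_prop)]
  simpa using (hF.isSymmSndFDerivAt (by simp)) (1, 0) (0, 1)

end NullDerivatives

namespace SymmetricSpacetime

variable {n : ℕ} {k C : ℝ} (M : SymmetricSpacetime n k C) {q : ℝ × ℝ}

theorem interior_subset_diff : interior M.Q ⊆ M.Q \ M.Γ := by
  rw [M.interior_eq]
  exact sdiff_subset_sdiff_right subset_union_right

/-! ### The Einstein equations in null coordinates -/

theorem eventually_nondegenerate {x : Fin 2 ⊕ Fin n → ℝ} (hx : base x ∈ interior M.Q)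
    (hV : fibre x ∈ M.V) : ∀ᶠ y in 𝓝 x, IsNondegenerateAt M.Ω M.r M.γ y := by
  filter_upwards [continuous_base.continuousAt (isOpen_interior.mem_nhds hx),
    continuous_fibre.continuousAt (M.V_open.mem_nhds hV)] with y hy hyV
  have hy' := M.interior_subset_diff hy
  exact ⟨(M.Ω_pos _ hy').ne', (M.r_pos _ hy').ne',
    (M.γ_posDef _ hyV).det_pos.ne'.isUnit,
    (M.r_regular _ hy').differentiableAt (by simp)⟩

theorem exists_over (q : ℝ × ℝ) :
    ∃ x : Fin 2 ⊕ Fin n → ℝ, base x = q ∧ fibre x ∈ M.V := by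
  obtain ⟨y, hy⟩ := M.V_nonempty
  exact ⟨Sum.elim ![q.1, q.2] y, rfl, hy⟩

variable (hn : 2 ≤ n)
include hn

theorem nullD_div_sq (hq : q ∈ interior M.Q) (a : Fin 2) :
    nullD a (fun z => nullD a M.r z / M.Ω z ^ 2) q =
      -(2 / n) * M.r q * (if a = 0 then M.Tuu q else M.Tvv q) / M.Ω q ^ 2 := by
  obtain ⟨x, rfl, hV⟩ := M.exists_over q
  have hQ := M.interior_subset_diff hq
  have hr := (M.r_pos _ hQ).ne'
  have hΩ := (M.Ω_pos _ hQ).ne'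
  have hn0 : (n : ℝ) ≠ 0 := by positivity
  have dΩ : DifferentiableAt ℝ M.Ω (base x) := (M.Ω_regular _ hQ).differentiableAt (by simp)
  have dr : DifferentiableAt ℝ M.r (base x) := (M.r_regular _ hQ).differentiableAt (by simp)
  have dD : DifferentiableAt ℝ (nullD a M.r) (base x) := by
    obtain rfl | rfl : a = 0 ∨ a = 1 := by fin_cases a <;> simp
    · exact (contDiffAt_du (M.r_regular _ hQ)).differentiableAt (by simp)
    · exact (contDiffAt_dv (M.r_regular _ hQ)).differentiableAt (by simp)
  have key := M.einstein x hq hV (Sum.inl a) (Sum.inl a)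
  have e1 : stressTensor M.Tuu M.Tuv M.Tvv M.P M.γ x (Sum.inl a) (Sum.inl a)
      = if a = 0 then M.Tuu (base x) else M.Tvv (base x) := by
    fin_cases a <;> simp [stressTensor]
  rw [einsteinTensor, spacetimeMetric_inl_inl, if_pos rfl, e1,
    ricci_null (M.eventually_nondegenerate hq hV), nullD_metricUV a dΩ,
    nullD_div a dD dr hr] at key
  have h2 : nullD a (fun z => M.Ω z ^ 2) (base x) = 2 * M.Ω (base x) * nullD a M.Ω (base x) := by
    simp only [pow_two]
    rw [nullD_mul a dΩ dΩ]; ring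
  rw [nullD_div a dD (dΩ.fun_pow 2) (pow_ne_zero 2 hΩ), h2]
  simp only [metricUV] at key
  generalize (if a = 0 then M.Tuu (base x) else M.Tvv (base x)) = T at *
  field_simp at key ⊢
  refine mul_left_cancel₀ (mul_ne_zero two_ne_zero hr) ?_
  linear_combination -key

/-- In the mixed Einstein equation the mixed Ricci components cancel against their share of the
scalar curvature. Only the fibre trace remains, so second derivatives of `Ω` never enter. -/
theorem mul_dv_nu (hq : q ∈ interior M.Q) :
    M.r q * dv M.nu q = 2 / n * M.r q ^ 2 * M.Tuv q
      - (n - 1) * (k * M.Ω q ^ 2 / 4 + M.nu q * M.lam q) := by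
  obtain ⟨x, rfl, hV⟩ := M.exists_over q
  have hQ := M.interior_subset_diff hq
  have hr := (M.r_pos _ hQ).ne'
  have hΩ := (M.Ω_pos _ hQ).ne'
  have hn0 : (n : ℝ) ≠ 0 := by positivity
  have hR := M.r_regular _ hQ
  have dΩ : DifferentiableAt ℝ M.Ω (base x) := (M.Ω_regular _ hQ).differentiableAt (by simp)
  have dr : DifferentiableAt ℝ M.r (base x) := hR.differentiableAt (by simp)
  have hnd := M.eventually_nondegenerate hq hV
  -- The two mixed Ricci components contain the second derivatives of `Ω` in opposite orders, which
  -- need not agree. Averaging both equations removes the difference.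
  have k01 := M.einstein x hq hV (Sum.inl 0) (Sum.inl 1)
  have k10 := M.einstein x hq hV (Sum.inl 1) (Sum.inl 0)
  have hγu := (M.γ_posDef _ hV).det_pos.ne'.isUnit
  have hγs : (M.γ (fibre x)).IsSymm := by
    have := (M.γ_posDef _ hV).isHermitian
    rwa [Matrix.IsHermitian, Matrix.conjTranspose_eq_transpose_of_trivial] at this
  have htr : ∑ i, ∑ j, (M.γ (fibre x))⁻¹ i j * M.γ (fibre x) i j = n := by
    have h1 : ((M.γ (fibre x))⁻¹ * M.γ (fibre x)).trace = n := by
      rw [Matrix.nonsing_inv_mul _ hγu, Matrix.trace_one]; simp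
    rw [← h1, Matrix.trace]
    refine Finset.sum_congr rfl fun i _ => ?_
    rw [Matrix.diag_apply, Matrix.mul_apply]
    exact Finset.sum_congr rfl fun j _ => by rw [hγs.apply]
  have dd : ∀ a : Fin 2, DifferentiableAt ℝ (nullD a M.r) (base x) := by
    intro a
    obtain rfl | rfl : a = 0 ∨ a = 1 := by fin_cases a <;> simp
    · exact (contDiffAt_du hR).differentiableAt (by simp)
    · exact (contDiffAt_dv hR).differentiableAt (by simp)
  have hf : metricUV M.Ω (base x) ≠ 0 := by simp [metricUV, hΩ]
  have df : DifferentiableAt ℝ (metricUV M.Ω) (base x) := by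
    unfold metricUV; fun_prop
  have hE : ∀ a : Fin 2, nullD a (fun q => M.r q * nullD (1 - a) M.r q / metricUV M.Ω q) (base x)
      = ((nullD a M.r (base x) * nullD (1 - a) M.r (base x)
          + M.r (base x) * nullD a (nullD (1 - a) M.r) (base x)) * metricUV M.Ω (base x)
          - M.r (base x) * nullD (1 - a) M.r (base x) * -(M.Ω (base x) * nullD a M.Ω (base x)))
        / metricUV M.Ω (base x) ^ 2 := by
    intro a
    rw [nullD_div a (dr.fun_mul (dd _)) df hf, nullD_mul a dr (dd _),
      nullD_metricUV a dΩ]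
  have hric := ricci_fibre hnd hγs
  simp only [hE, M.γ_einstein _ hV] at hric
  generalize hEdef : (∑ a : Fin 2, _ : ℝ) = E at hric
  have hscal : scalarCurvature (spacetimeMetric M.Ω M.r M.γ) x =
      (metricUV M.Ω (base x))⁻¹ * (ricci (spacetimeMetric M.Ω M.r M.γ) (Sum.inl 0) (Sum.inl 1) x
        + ricci (spacetimeMetric M.Ω M.r M.γ) (Sum.inl 1) (Sum.inl 0) x)
      + (M.r (base x) ^ 2)⁻¹ * (n * (k * (n - 1) + E)) := by
    have hsum : ∑ i, ∑ j, (M.r (base x) ^ 2)⁻¹ * (M.γ (fibre x))⁻¹ i j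
        * ricci (spacetimeMetric M.Ω M.r M.γ) (Sum.inr i) (Sum.inr j) x
        = (M.r (base x) ^ 2)⁻¹ * (n * (k * (n - 1) + E)) := by
      trans (M.r (base x) ^ 2)⁻¹ * ((∑ i, ∑ j, (M.γ (fibre x))⁻¹ i j * M.γ (fibre x) i j)
        * (k * (n - 1) + E))
      · rw [Finset.sum_mul, Finset.mul_sum]
        refine Finset.sum_congr rfl fun i _ => ?_
        rw [Finset.sum_mul, Finset.mul_sum]
        refine Finset.sum_congr rfl fun j _ => ?_
        rw [hric]; ring
      · rw [htr]
    rw [scalarCurvature, spacetimeMetric_inv hnd.self_of_nhds]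
    simp only [Fintype.sum_sum_type, Fin.sum_univ_two]
    simp [hsum]
    ring
  simp only [einsteinTensor, spacetimeMetric_inl_inl, hscal] at k01 k10
  simp [stressTensor] at k01 k10
  have hcomm := du_dv_comm hR
  simp only [Fin.sum_univ_two, nullD_metricUV _ dΩ] at hEdef
  have e0 : nullD 0 M.r = M.nu := by ext; simp [nullD, nu]
  have e1 : nullD 1 M.r = M.lam := by ext; simp [nullD, lam]
  change du M.lam (base x) = dv M.nu (base x) at hcomm
  simp only [sub_zero, sub_self, e0, e1] at hEdef
  simp only [nullD, if_true, one_ne_zero, if_false, metricUV, hcomm] at hEdef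
  have hE' : E = 4 / M.Ω (base x) ^ 2
      * (M.r (base x) * dv M.nu (base x) + (n - 1) * (M.nu (base x) * M.lam (base x))) := by
    rw [← hEdef]
    field_simp
    ring
  have hT : -metricUV M.Ω (base x) * (M.r (base x) ^ 2)⁻¹ * (n * (k * (n - 1) + E))
      = 4 * M.Tuv (base x) := by
    field_simp at k01 k10 ⊢
    linear_combination (k01 + k10) / 2
  rw [hE', metricUV] at hT
  field_simp at hT ⊢
  linear_combination hT

theorem hasDerivAt_nu_div_sq (hq : q ∈ interior M.Q) :
    HasDerivAt (fun u => M.nu (u, q.2) / M.Ω (u, q.2) ^ 2)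
      (-(2 / n) * M.r q * M.Tuu q / M.Ω q ^ 2) q.1 := by
  have hQ := M.interior_subset_diff hq
  have dν : DifferentiableAt ℝ M.nu q :=
    (contDiffAt_du (M.r_regular _ hQ)).differentiableAt (by simp)
  have dΩ : DifferentiableAt ℝ M.Ω q := (M.Ω_regular _ hQ).differentiableAt (by simp)
  have h := M.nullD_div_sq hn hq 0
  rw [if_pos rfl] at h
  rw [← h]
  have h0 : M.Ω q ^ 2 ≠ 0 := pow_ne_zero 2 (M.Ω_pos _ hQ).ne'
  have d3 : DifferentiableAt ℝ (fun z => M.nu z / M.Ω z ^ 2) q := by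
    fun_prop (disch := exact h0)
  exact hasDerivAt_du d3

theorem hasDerivAt_lam_div_sq (hq : q ∈ interior M.Q) :
    HasDerivAt (fun v => M.lam (q.1, v) / M.Ω (q.1, v) ^ 2)
      (-(2 / n) * M.r q * M.Tvv q / M.Ω q ^ 2) q.2 := by
  have hQ := M.interior_subset_diff hq
  have dl : DifferentiableAt ℝ M.lam q :=
    (contDiffAt_dv (M.r_regular _ hQ)).differentiableAt (by simp)
  have dΩ : DifferentiableAt ℝ M.Ω q := (M.Ω_regular _ hQ).differentiableAt (by simp)
  have h := M.nullD_div_sq hn hq 1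
  rw [if_neg one_ne_zero] at h
  rw [← h]
  have h0 : M.Ω q ^ 2 ≠ 0 := pow_ne_zero 2 (M.Ω_pos _ hQ).ne'
  have d3 : DifferentiableAt ℝ (fun z => M.lam z / M.Ω z ^ 2) q := by
    fun_prop (disch := exact h0)
  exact hasDerivAt_dv d3

omit hn in
theorem du_lam (hq : q ∈ M.Q \ M.Γ) : du M.lam q = dv M.nu q :=
  du_dv_comm (M.r_regular _ hq)

/-- Group `νλ/Ω²` as `(ν/Ω²) · λ`: the null-null equation differentiates the first factor and the
wave equation the second, since `∂_u λ = ∂_v ν`. The geometric terms cancel against the derivative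
of `r^(n-1)`. -/
theorem hasDerivAt_mass_u (hq : q ∈ interior M.Q) :
    HasDerivAt (fun u => M.mass (u, q.2))
      (4 * M.r q ^ n / (n * M.Ω q ^ 2) * (M.nu q * M.Tuv q - M.lam q * M.Tuu q)) q.1 := by
  have hQ := M.interior_subset_diff hq
  have hr := (M.r_pos _ hQ).ne'
  have hΩ := (M.Ω_pos _ hQ).ne'
  have hn0 : (n : ℝ) ≠ 0 := by positivity
  have dl : DifferentiableAt ℝ M.lam q :=
    (contDiffAt_dv (M.r_regular _ hQ)).differentiableAt (by simp)
  have hl := hasDerivAt_du dl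
  rw [M.du_lam hQ] at hl
  have hr' : HasDerivAt (fun u => M.r (u, q.2)) (M.nu q) q.1 :=
    hasDerivAt_du ((M.r_regular _ hQ).differentiableAt (by simp))
  have h := ((hr'.fun_pow (n - 1)).div_const 2).fun_mul
    (((((M.hasDerivAt_nu_div_sq hn hq).fun_mul hl).const_mul 4)).const_add k)
  have hw := M.mul_dv_nu hn hq
  refine (h.congr_deriv ?_).congr_of_eventuallyEq (Eventually.of_forall fun u => ?_)
  -- With `n = m + 2` the truncated exponents become `m + 1` and `m`.
  · obtain ⟨m, rfl⟩ := Nat.exists_eq_add_of_le' hn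
    have e1 : m + 2 - 1 = m + 1 := rfl
    simp only [e1, Nat.add_sub_cancel, Prod.mk.eta]
    push_cast at hw hn0 ⊢
    field_simp at hw ⊢
    linear_combination M.nu q * M.r q ^ m * hw
  · simp only [mass]; ring

theorem hasDerivAt_mass_v (hq : q ∈ interior M.Q) :
    HasDerivAt (fun v => M.mass (q.1, v))
      (4 * M.r q ^ n / (n * M.Ω q ^ 2) * (M.lam q * M.Tuv q - M.nu q * M.Tvv q)) q.2 := by
  have hQ := M.interior_subset_diff hq
  have hr := (M.r_pos _ hQ).ne'
  have hΩ := (M.Ω_pos _ hQ).ne'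
  have hn0 : (n : ℝ) ≠ 0 := by positivity
  have dν : DifferentiableAt ℝ M.nu q :=
    (contDiffAt_du (M.r_regular _ hQ)).differentiableAt (by simp)
  have hν := hasDerivAt_dv dν
  have hr' : HasDerivAt (fun v => M.r (q.1, v)) (M.lam q) q.2 :=
    hasDerivAt_dv ((M.r_regular _ hQ).differentiableAt (by simp))
  have h := ((hr'.fun_pow (n - 1)).div_const 2).fun_mul
    (((((M.hasDerivAt_lam_div_sq hn hq).fun_mul hν).const_mul 4)).const_add k)
  have hw := M.mul_dv_nu hn hq
  refine (h.congr_deriv ?_).congr_of_eventuallyEq (Eventually.of_forall fun v => ?_)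
  · obtain ⟨m, rfl⟩ := Nat.exists_eq_add_of_le' hn
    have e1 : m + 2 - 1 = m + 1 := rfl
    simp only [e1, Nat.add_sub_cancel, Prod.mk.eta]
    push_cast at hw hn0 ⊢
    field_simp at hw ⊢
    linear_combination M.lam q * M.r q ^ m * hw
  · simp only [mass]; ring

end SymmetricSpacetime

/-! ### Domains of dependence in the plane -/

section Causal

variable {X : Set (ℝ × ℝ)} {p q : ℝ × ℝ} {ε : ℝ}

theorem exists_tendsto_of_antitoneOn {f : ℝ → ℝ} {b : ℝ} (hf : AntitoneOn f (Ici 0))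
    (hb : ∀ t, 0 ≤ t → b ≤ f t) : ∃ l, Tendsto f atTop (𝓝 l) := by
  have ha : Antitone fun t => f (max t 0) := fun s t hst =>
    hf (mem_Ici.2 (le_max_right _ _)) (mem_Ici.2 (le_max_right _ _)) (max_le_max_right _ hst)
  have h := tendsto_atTop_ciInf ha ⟨b, by rintro _ ⟨t, rfl⟩; exact hb _ (le_max_right _ _)⟩
  refine ⟨_, h.congr' ?_⟩
  filter_upwards [eventually_ge_atTop 0] with t ht
  rw [max_eq_left ht]

theorem isPastInextendible_line {w : ℝ × ℝ} (hw : 0 ≤ w) (hw0 : w ≠ 0) (q : ℝ × ℝ) :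
    IsPastInextendible (fun t => q - t • w) q where
  start := by simp
  continuousOn := by fun_prop
  causal := by
    intro s _ t _ hst
    exact sub_le_sub_left (smul_le_smul_of_nonneg_right hst hw) q
  no_endpoint := by
    rintro ⟨z, hz⟩
    have h1 : Tendsto (fun t : ℝ => q.1 - t * w.1) atTop (𝓝 z.1) :=
      (continuous_fst.tendsto z).comp hz
    have h2 : Tendsto (fun t : ℝ => q.2 - t * w.2) atTop (𝓝 z.2) :=
      (continuous_snd.tendsto z).comp hz
    have aux : ∀ a b c : ℝ, 0 < b → ¬ Tendsto (fun t : ℝ => a - t * b) atTop (𝓝 c) := by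
      intro a b c hb
      refine not_tendsto_nhds_of_tendsto_atBot ?_ c
      have : Tendsto (fun t : ℝ => t * b) atTop atTop := tendsto_id.atTop_mul_const hb
      exact tendsto_atBot_add_const_left _ a (tendsto_neg_atTop_atBot.comp this)
    rcases (show (0 : ℝ) ≤ w.1 from hw.1).eq_or_lt with h | h
    · rcases (show (0 : ℝ) ≤ w.2 from hw.2).eq_or_lt with h' | h'
      · exact hw0 (Prod.ext h.symm h'.symm)
      · exact aux _ _ _ h' h2
    · exact aux _ _ _ h h1

theorem exists_line_mem {w : ℝ × ℝ} (hw : 0 ≤ w) (hw0 : w ≠ 0)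
    (hq : q ∈ domainOfDependence X) : ∃ t : ℝ, 0 ≤ t ∧ q - t • w ∈ X :=
  hq _ (isPastInextendible_line hw hw0 q)

theorem exists_vertical_mem (hq : q ∈ domainOfDependence X) : ∃ b ≤ q.2, (q.1, b) ∈ X := by
  obtain ⟨t, ht, h⟩ := exists_line_mem (w := (0, 1)) ⟨le_rfl, zero_le_one⟩ (by simp) hq
  exact ⟨q.2 - t, by linarith, by convert h using 1; ext <;> simp⟩

theorem exists_horizontal_mem (hq : q ∈ domainOfDependence X) : ∃ a ≤ q.1, (a, q.2) ∈ X := by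
  obtain ⟨t, ht, h⟩ := exists_line_mem (w := (1, 0)) ⟨zero_le_one, le_rfl⟩ (by simp) hq
  exact ⟨q.1 - t, by linarith, by convert h using 1; ext <;> simp⟩

/-- Prepend the segment from `p` to `q` to a curve from `q`. The longer curve must meet `X`, and it
cannot do so on the segment. -/
theorem domainOfDependence_of_segment (hp : p ∈ domainOfDependence X) (hqp : q ≤ p)
    (hX : ∀ t ∈ Icc (0 : ℝ) 1, p + t • (q - p) ∉ X) : q ∈ domainOfDependence X := by
  intro c hc
  have hcont : Continuous fun t : ℝ => c (max (t - 1) 0) :=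
    hc.continuousOn.comp_continuous (by fun_prop) fun t => mem_Ici.2 (le_max_right _ _)
  have hlate : ∀ t : ℝ, 1 ≤ t →
      p + min t 1 • (q - p) + (c (max (t - 1) 0) - c 0) = c (t - 1) := by
    intro t ht
    rw [min_eq_right ht, max_eq_left (by linarith), hc.start]
    simp
  -- The segment is traversed up to time `1` and then frozen at `q`; the increment of `c`, delayed
  -- by `1`, takes over from there.
  obtain ⟨t, ht, hm⟩ := hp (fun t => p + min t 1 • (q - p) + (c (max (t - 1) 0) - c 0)) {
    start := by simp
    continuousOn := by
      have : Continuous fun t : ℝ => p + min t 1 • (q - p) := by fun_prop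
      exact (this.add (hcont.sub continuous_const)).continuousOn
    causal := by
      intro s _ t _ hst
      refine add_le_add (add_le_add_right ?_ p) (sub_le_sub_right ?_ _)
      · have h := smul_le_smul_of_nonneg_right (min_le_min_right 1 hst) (sub_nonneg.2 hqp)
        rw [← neg_sub p q, smul_neg, smul_neg]
        exact neg_le_neg h
      · exact hc.causal (mem_Ici.2 (le_max_right _ _)) (mem_Ici.2 (le_max_right _ _))
          (max_le_max_right _ (by linarith))
    no_endpoint := by
      rintro ⟨z, hz⟩
      refine hc.no_endpoint ⟨z, ?_⟩
      refine (hz.comp (tendsto_atTop_add_const_right atTop (1 : ℝ) tendsto_id)).congr' ?_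
      filter_upwards [eventually_ge_atTop 0] with t ht
      simp only [Function.comp, id]
      rw [hlate _ (by linarith)]
      simp }
  rcases le_total t 1 with h | h
  · refine absurd hm ?_
    simp only [min_eq_left h, max_eq_right (by linarith : t - 1 ≤ 0), sub_self, add_zero]
    exact hX t ⟨ht, h⟩
  · exact ⟨t - 1, by linarith, by rw [← hlate t h]; exact hm⟩

/-- Vertical and horizontal null lines confine the domain to the rectangle. Conversely, a
past-directed curve that never reached the two past edges would have monotone coordinates bounded
below, hence an endpoint. -/
theorem domainOfDependence_nullCorner (p : ℝ × ℝ) (hε : 0 < ε) :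
    domainOfDependence (nullCorner p ε) = Icc (p.1 - ε, p.2 - ε) p := by
  ext q
  constructor
  · intro hq
    obtain ⟨b, hb, hv⟩ := exists_vertical_mem hq
    obtain ⟨a, ha, hh⟩ := exists_horizontal_mem hq
    simp only [nullCorner, mem_union, mem_prod, mem_singleton_iff, mem_Icc] at hv hh
    refine ⟨⟨?_, ?_⟩, ⟨?_, ?_⟩⟩ <;> rcases hv with hv | hv <;>
      rcases hh with hh | hh <;> linarith [hv.1, hv.2, hh.1, hh.2]
  · rintro ⟨⟨h1, h2⟩, h3, h4⟩ c hc
    simp only at h1 h2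
    have hle : ∀ t, 0 ≤ t → c t ≤ p := fun t ht => by
      have := hc.causal (mem_Ici.2 le_rfl) (mem_Ici.2 ht) ht
      rw [hc.start] at this
      exact this.trans ⟨h3, h4⟩
    -- A zero of `h` below `p` is a point of the corner, so the intermediate value theorem applies
    -- to `h`.
    let h : ℝ → ℝ := fun t => min ((c t).1 - (p.1 - ε)) ((c t).2 - (p.2 - ε))
    have hcont : ContinuousOn h (Ici 0) :=
      (hc.continuousOn.fst.sub continuousOn_const).inf (hc.continuousOn.snd.sub continuousOn_const)
    have h0 : 0 ≤ h 0 := by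
      simp only [h, hc.start]
      exact le_min (by linarith) (by linarith)
    have hT : ∃ T, 0 ≤ T ∧ h T ≤ 0 := by
      by_contra! hcon
      have hpos : ∀ t, 0 ≤ t → p.1 - ε ≤ (c t).1 ∧ p.2 - ε ≤ (c t).2 := fun t ht => by
        have := lt_min_iff.1 (hcon t ht)
        exact ⟨by linarith [this.1], by linarith [this.2]⟩
      obtain ⟨l1, hl1⟩ := exists_tendsto_of_antitoneOn (f := fun t => (c t).1) (b := p.1 - ε)
        (fun s hs t ht hst => (hc.causal hs ht hst).1) fun t ht => (hpos t ht).1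
      obtain ⟨l2, hl2⟩ := exists_tendsto_of_antitoneOn (f := fun t => (c t).2) (b := p.2 - ε)
        (fun s hs t ht hst => (hc.causal hs ht hst).2) fun t ht => (hpos t ht).2
      exact hc.no_endpoint ⟨(l1, l2), hl1.prodMk_nhds hl2⟩
    obtain ⟨T, hT0, hT⟩ := hT
    obtain ⟨t, ht, hz⟩ := intermediate_value_Icc' hT0
      (hcont.mono fun s hs => hs.1) ⟨hT, h0⟩
    refine ⟨t, ht.1, ?_⟩
    have hlet := hle t ht.1
    have g1 : h t ≤ (c t).1 - (p.1 - ε) := min_le_left _ _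
    have g2 : h t ≤ (c t).2 - (p.2 - ε) := min_le_right _ _
    rw [hz] at g1 g2
    simp only [nullCorner, mem_union, mem_prod, mem_singleton_iff, mem_Icc]
    rcases min_choice ((c t).1 - (p.1 - ε)) ((c t).2 - (p.2 - ε)) with h' | h'
    · left
      have : (c t).1 - (p.1 - ε) = 0 := h'.symm.trans hz
      exact ⟨by linarith, by linarith, hlet.2⟩
    · right
      have : (c t).2 - (p.2 - ε) = 0 := h'.symm.trans hz
      exact ⟨⟨by linarith, hlet.1⟩, by linarith⟩

theorem nullCorner_subset (p : ℝ × ℝ) (hε : 0 < ε) :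
    nullCorner p ε ⊆ Icc (p.1 - ε, p.2 - ε) p \ {p} := by
  rintro ⟨u, v⟩ h
  simp only [nullCorner, mem_union, mem_prod, mem_singleton_iff, mem_Icc] at h
  refine ⟨⟨⟨?_, ?_⟩, ⟨?_, ?_⟩⟩, ?_⟩
  iterate 4
    simp only
    rcases h with h | h <;> linarith [h.1, h.2]
  rintro rfl
  rcases h with h | h <;> linarith [h.1, h.2]

theorem isCompact_nullCorner (p : ℝ × ℝ) (ε : ℝ) : IsCompact (nullCorner p ε) :=
  (isCompact_singleton.prod isCompact_Icc).union (isCompact_Icc.prod isCompact_singleton)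

/-- Continuous induction: at the infimum of the failures the limit hypothesis gives `P`, and the
step hypothesis then pushes every failure strictly further up. -/
theorem forall_Icc_of_step_of_limit {P : ℝ → Prop} {a b : ℝ} (ha : P a)
    (hstep : ∀ t ∈ Ico a b, P t → ∃ s > t, ∀ x ∈ Ioo t s, P x)
    (hlim : ∀ t ∈ Ioc a b, (∀ s ∈ Ico a t, P s) → P t) : ∀ t ∈ Icc a b, P t := by
  by_contra! hbad
  obtain ⟨t1, ht1, hP1⟩ := hbad
  have hne : {t ∈ Icc a b | ¬ P t}.Nonempty := ⟨t1, ht1, hP1⟩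
  have hbd : BddBelow {t ∈ Icc a b | ¬ P t} := ⟨a, fun t ht => ht.1.1⟩
  set t0 := sInf {t ∈ Icc a b | ¬ P t} with ht0
  have ha0 : a ≤ t0 := le_csInf hne fun t ht => ht.1.1
  have h01 : t0 ≤ t1 := csInf_le hbd ⟨ht1, hP1⟩
  have hbelow : ∀ s ∈ Ico a t0, P s := by
    intro s hs
    by_contra h
    exact absurd (csInf_le hbd ⟨⟨hs.1, by linarith [hs.2, ht1.2]⟩, h⟩) (not_le.2 hs.2)
  have hP0 : P t0 := by
    rcases ha0.eq_or_lt with h | h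
    · rw [← h]; exact ha
    · exact hlim t0 ⟨h, h01.trans ht1.2⟩ hbelow
  have h01' : t0 < t1 := h01.lt_of_ne fun h => hP1 (h ▸ hP0)
  obtain ⟨s, hs, hPs⟩ := hstep t0 ⟨ha0, h01'.trans_le ht1.2⟩ hP0
  refine absurd (le_csInf hne (a := s) fun t ht => ?_) (not_le.2 hs)
  by_contra h
  push Not at h
  rcases (csInf_le hbd ht).eq_or_lt with h' | h'
  · exact ht.2 (h' ▸ hP0)
  · exact ht.2 (hPs t ⟨h', h⟩)

end Causal

/-! ### Null corners as generating sets. -/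

namespace SymmetricSpacetime

variable {n : ℕ} {k C : ℝ} (M : SymmetricSpacetime n k C) {p q : ℝ × ℝ} {ε : ℝ}

theorem pastNhd_eq (p : ℝ × ℝ) (hε : 0 < ε) : pastNhd p ε = Icc (p.1 - ε, p.2 - ε) p \ {p} := by
  rw [pastNhd, domainOfDependence_nullCorner p hε]

variable {M}

theorem Admissible.nullCorner_subset (h : M.Admissible p ε) :
    nullCorner p ε ⊆ M.Q \ M.Γ := by
  refine (Collapse.nullCorner_subset p h.1).trans ?_
  rw [← pastNhd_eq p h.1]
  exact h.2.trans (sdiff_subset_sdiff_right subset_union_right)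

/-- A point of the past of `p` outside the rectangle lies below one of the two far ends of the
corner. This makes the corner an eligible set in the extension criterion. -/
theorem Admissible.generates (h : M.Admissible p ε) : M.Generates (nullCorner p ε) p := by
  refine ⟨isCompact_nullCorner p ε, h.nullCorner_subset.trans sdiff_subset, ?_⟩
  have hε := h.1
  rw [domainOfDependence_nullCorner p hε]
  rintro q (rfl | ⟨hq, hQ⟩)
  · exact Or.inl ⟨⟨by simp [hε.le], by simp [hε.le]⟩, le_rfl⟩
  by_cases h1 : p.1 - ε ≤ q.1
  · by_cases h2 : p.2 - ε ≤ q.2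
    · exact Or.inl ⟨⟨h1, h2⟩, hq⟩
    · refine Or.inr ⟨mem_biUnion (x := (p.1, p.2 - ε)) ?_ ⟨hq.1, ?_⟩, hQ⟩
      · exact Or.inr ⟨⟨by simp [hε.le], le_rfl⟩, rfl⟩
      · simp only; linarith
  · refine Or.inr ⟨mem_biUnion (x := (p.1 - ε, p.2)) ?_ ⟨?_, hq.2⟩, hQ⟩
    · exact Or.inl ⟨rfl, by simp [hε.le], le_rfl⟩
    · simp only; linarith

end SymmetricSpacetime

namespace SymmetricSpacetime

variable {n : ℕ} {k C : ℝ} {M : SymmetricSpacetime n k C} {p q : ℝ × ℝ} {ε : ℝ}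
  {X : Set (ℝ × ℝ)}

/-! ### Past neighbourhoods of first singularities -/

theorem mem_domainOfDependence_of_generates (hp : p ∉ M.Q) (hX : M.Generates X p) :
    p ∈ domainOfDependence X :=
  (hX.2.2 (mem_insert _ _)).resolve_right fun h => hp h.2

theorem Generates.exists_vertical (hX : M.Generates X p) (hp : p ∉ M.Q) :
    ∃ b < p.2, (p.1, b) ∈ M.Q := by
  obtain ⟨b, hb, h⟩ := exists_vertical_mem (mem_domainOfDependence_of_generates hp hX)
  refine ⟨b, hb.lt_of_ne ?_, hX.2.1 h⟩
  rintro rfl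
  exact hp (hX.2.1 h)

theorem Generates.exists_horizontal (hX : M.Generates X p) (hp : p ∉ M.Q) :
    ∃ a < p.1, (a, p.2) ∈ M.Q := by
  obtain ⟨a, ha, h⟩ := exists_horizontal_mem (mem_domainOfDependence_of_generates hp hX)
  refine ⟨a, ha.lt_of_ne ?_, hX.2.1 h⟩
  rintro rfl
  exact hp (hX.2.1 h)

/-- A point of the domain of dependence strictly below a first singularity, that is a limit of
points of `Q` in its past, belongs to `Q`. -/
theorem IsFirstSingularity.mem_of_mem_closure (hp : M.IsFirstSingularity p)
    (hX : M.Generates X p) (hqp : q ≤ p) (hne : q ≠ p) (hq : q ∈ domainOfDependence X)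
    (hcl : q ∈ closure (Iic q ∩ M.Q)) : q ∈ M.Q := by
  by_contra hqQ
  have hsub : causalPast q ∩ M.Q ⊆ causalPast p ∩ M.Q :=
    inter_subset_inter_left _ (Iic_subset_Iic.2 hqp)
  have hECG : M.EventuallyCompactlyGenerated q :=
    ⟨X, hX.1, hX.2.1, insert_subset (Or.inl hq)
      (hsub.trans ((subset_insert _ _).trans hX.2.2))⟩
  -- If the pasts agreed, the points of `Q` on the two null lines below `p` would lie below `q`,
  -- forcing `q = p`.
  have hss : causalPast q ∩ M.Q ⊂ causalPast p ∩ M.Q := by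
    refine ssubset_of_subset_not_subset hsub fun h => ?_
    obtain ⟨b, hb, hbQ⟩ := hX.exists_vertical hp.notMem
    obtain ⟨a, ha, haQ⟩ := hX.exists_horizontal hp.notMem
    have h1 := (h ⟨(⟨le_rfl, hb.le⟩ : ((p.1, b) : ℝ × ℝ) ≤ p), hbQ⟩).1.1
    have h2 := (h ⟨(⟨ha.le, le_rfl⟩ : ((a, p.2) : ℝ × ℝ) ≤ p), haQ⟩).1.2
    exact hne (le_antisymm hqp ⟨h1, h2⟩)
  obtain ⟨z, hz, hqz⟩ := hp.first q (closure_mono inter_subset_right hcl) hECG hss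
  have hzq : z ≤ q := by
    have : z ∈ causalPast q ∩ M.Q := hqz ▸ ⟨mem_Iic.2 le_rfl, hz⟩
    exact this.1
  -- `q` is a limit of points below `z`, and the past of `z` is closed.
  have hqz' : q ≤ z := by
    have : Iic q ∩ M.Q ⊆ Iic z := by
      change causalPast q ∩ M.Q ⊆ Iic z
      rw [hqz]
      exact inter_subset_left
    exact closure_minimal this isClosed_Iic hcl
  exact hqQ (le_antisymm hqz' hzq ▸ hz)

/-- `Q` has points on both null lines strictly below `p`, so a nearby point of `S` outside the open
past of `p` would have a point of `Q` in its past. A point of `S` strictly below `p` is in turn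
timelike related to points of `S` even closer to `p`. -/
theorem Generates.notMem_closure_S (hX : M.Generates X p) (hp : p ∉ M.Q) : p ∉ closure M.S := by
  intro hcl
  obtain ⟨b, hb, hbQ⟩ := hX.exists_vertical hp
  obtain ⟨a, ha, haQ⟩ := hX.exists_horizontal hp
  obtain ⟨s, hs, hsS⟩ := mem_closure_iff.1 hcl (Ioi a ×ˢ Ioi b) (isOpen_Ioi.prod isOpen_Ioi)
    ⟨ha, hb⟩
  have h1 : s.1 < p.1 := by
    by_contra! h
    have := M.S_past s hsS _ hbQ ⟨h, (mem_Ioi.1 hs.2).le⟩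
    exact (mem_Ioi.1 hs.2).ne (congrArg Prod.snd this)
  have h2 : s.2 < p.2 := by
    by_contra! h
    have := M.S_past s hsS _ haQ ⟨(mem_Ioi.1 hs.1).le, h⟩
    exact (mem_Ioi.1 hs.1).ne (congrArg Prod.fst this)
  obtain ⟨t, ht, htS⟩ := mem_closure_iff.1 hcl (Ioi s.1 ×ˢ Ioi s.2)
    (isOpen_Ioi.prod isOpen_Ioi) ⟨h1, h2⟩
  have h3 := mem_Ioi.1 ht.1
  have h4 := mem_Ioi.1 ht.2
  rcases M.S_spacelike s hsS t htS (fun h => h3.ne (congrArg Prod.fst h)) with h | h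
  · exact lt_asymm h.2 h4
  · exact lt_asymm h.1 h3

theorem mem_ball_iff {δ : ℝ} : q ∈ Metric.ball p δ ↔ |q.1 - p.1| < δ ∧ |q.2 - p.2| < δ := by
  rw [Metric.mem_ball, Prod.dist_eq, max_lt_iff, Real.dist_eq, Real.dist_eq]

/-- A ball around the first singularity that avoids the boundary curves and `X`. -/
theorem IsFirstSingularity.exists_ball (hp : M.IsFirstSingularity p) (hpΓ : p ∉ closure M.Γ)
    (hX : M.Generates X p) :
    ∃ δ > 0, Disjoint (Metric.ball p δ) (M.S ∪ M.Γ) ∧ Disjoint (Metric.ball p δ) X := by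
  have hcl : IsClosed (closure M.S ∪ closure M.Γ ∪ X) :=
    (isClosed_closure.union isClosed_closure).union hX.1.isClosed
  have hmem : p ∈ (closure M.S ∪ closure M.Γ ∪ X)ᶜ := by
    rintro ((h | h) | h)
    · exact hX.notMem_closure_S hp.notMem h
    · exact hpΓ h
    · exact hp.notMem (hX.2.1 h)
  obtain ⟨δ, hδ, hsub⟩ := Metric.isOpen_iff.1 hcl.isOpen_compl p hmem
  refine ⟨δ, hδ, ?_, ?_⟩
  · rw [disjoint_left]
    rintro z hz (h | h)
    · exact hsub hz (Or.inl (Or.inl (subset_closure h)))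
    · exact hsub hz (Or.inl (Or.inr (subset_closure h)))
  · rw [disjoint_left]
    exact fun z hz h => hsub hz (Or.inr h)

theorem inter_ball_subset_interior {δ : ℝ} (h : Disjoint (Metric.ball p δ) (M.S ∪ M.Γ)) :
    M.Q ∩ Metric.ball p δ ⊆ interior M.Q := by
  rw [M.interior_eq]
  exact fun z hz => ⟨hz.1, disjoint_left.1 h hz.2⟩

/-- Once `Q` contains a point of the past of a first singularity close to it, it contains the
whole diamond in between. -/
theorem IsFirstSingularity.Icc_subset (hp : M.IsFirstSingularity p) (hX : M.Generates X p)
    {δ : ℝ} (hδ : Disjoint (Metric.ball p δ) (M.S ∪ M.Γ)) (hδX : Disjoint (Metric.ball p δ) X)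
    {q₀ : ℝ × ℝ} (hq₀ : q₀ ∈ M.Q) (hball : q₀ ∈ Metric.ball p δ) :
    Icc q₀ p \ {p} ⊆ M.Q := by
  rintro q ⟨⟨hq0, hqp⟩, hne⟩
  have hδ0 : 0 < δ := Metric.pos_of_mem_ball hball
  have hpb : p ∈ Metric.ball p δ := Metric.mem_ball_self hδ0
  have hIcc : Icc q₀ p ⊆ Metric.ball p δ := by
    intro z hz
    rw [mem_ball_iff, abs_lt, abs_lt] at hball ⊢
    have := hz.1.1; have := hz.1.2; have := hz.2.1; have := hz.2.2
    refine ⟨⟨?_, ?_⟩, ?_, ?_⟩ <;> linarith [hball.1.1, hball.2.1]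
  let l : ℝ → ℝ × ℝ := fun t => q₀ + t • (q - q₀)
  have lmono : Monotone l := fun s t hst =>
    add_le_add_right (smul_le_smul_of_nonneg_right hst (sub_nonneg.2 hq0)) _
  have lcont : Continuous l := by fun_prop
  have l0 : l 0 = q₀ := by simp [l]
  have l1 : l 1 = q := by simp [l]
  have lle : ∀ t ≤ 1, l t ≤ q := fun t ht => l1 ▸ lmono ht
  have lge : ∀ t, 0 ≤ t → q₀ ≤ l t := fun t ht => by
    have := lmono ht
    rwa [l0] at this
  -- Membership in `Q` spreads along the segment: it is open because the ball misses both boundary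
  -- curves, and it passes to limits by minimality of the singularity. The limits lie in the domain
  -- of dependence because the convex ball misses `X`.
  have key := forall_Icc_of_step_of_limit (P := fun t => l t ∈ M.Q) (a := 0) (b := 1)
    (by rwa [l0]) ?_ ?_ 1 ⟨zero_le_one, le_rfl⟩
  · simpa only [l1] using key
  · intro t ht hP
    have hint : l t ∈ interior M.Q := inter_ball_subset_interior hδ
      ⟨hP, hIcc ⟨lge t ht.1, (lle t ht.2.le).trans hqp⟩⟩
    have := lcont.continuousAt.preimage_mem_nhds (isOpen_interior.mem_nhds hint)
    obtain ⟨η, hη, hb⟩ := Metric.mem_nhds_iff.1 this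
    refine ⟨t + η, by linarith, fun x hx => interior_subset (hb ?_)⟩
    rw [Metric.mem_ball, Real.dist_eq, abs_lt]
    constructor <;> linarith [hx.1, hx.2]
  · intro t ht hP
    have hlp : l t ≤ p := (lle t ht.2).trans hqp
    refine hp.mem_of_mem_closure hX hlp ?_ ?_ ?_
    · intro h
      exact hne (le_antisymm hqp (h ▸ lle t ht.2))
    · refine domainOfDependence_of_segment (mem_domainOfDependence_of_generates hp.notMem hX) hlp
        fun s hs => disjoint_left.1 hδX ?_
      exact (convex_ball p δ).add_smul_sub_mem hpb (hIcc ⟨lge t ht.1.le, hlp⟩) hs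
    · refine mem_closure_of_tendsto (b := 𝓝[<] t) (lcont.continuousAt.tendsto.mono_left
        nhdsWithin_le_nhds) ?_
      filter_upwards [Ico_mem_nhdsLT ht.1] with s hs
      exact ⟨lmono hs.2.le, hP s hs⟩

/-- The part of a null curve `u = const` below a point of `Q` near a first singularity. -/
theorem vertical_mem {δ : ℝ} (hδ : Disjoint (Metric.ball p δ) (M.S ∪ M.Γ)) (hq : q ∈ M.Q)
    (hball : q ∈ Metric.ball p δ) :
    ∃ b ≤ p.2 - δ, (q.1, b) ∈ M.S ∪ M.Γ ∧ ∀ v ∈ Icc b q.2, (q.1, v) ∈ M.Q := by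
  obtain ⟨b, hb, hbS, hQ⟩ := M.constU_past q hq
  refine ⟨b, ?_, hbS, hQ⟩
  by_contra! h
  refine disjoint_left.1 hδ ?_ hbS
  rw [mem_ball_iff, abs_lt, abs_lt] at *
  refine ⟨hball.1, ?_, ?_⟩ <;> simp only <;> linarith [hball.2.2]

theorem exists_fst_of_mem_Γ {a b : ℝ × ℝ} {x : ℝ} (ha : a ∈ M.Γ) (hb : b ∈ M.Γ)
    (hx : x ∈ Icc a.1 b.1) : ∃ y, (x, y) ∈ M.Γ := by
  obtain ⟨z, hz, rfl⟩ := (M.Γ_connected.isPreconnected.image Prod.fst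
    continuous_fst.continuousOn).Icc_subset (mem_image_of_mem _ ha) (mem_image_of_mem _ hb) hx
  exact ⟨z.2, hz⟩

theorem exists_snd_of_mem_Γ {a b : ℝ × ℝ} {y : ℝ} (ha : a ∈ M.Γ) (hb : b ∈ M.Γ)
    (hy : y ∈ Icc a.2 b.2) : ∃ x, (x, y) ∈ M.Γ := by
  obtain ⟨z, hz, rfl⟩ := (M.Γ_connected.isPreconnected.image Prod.snd
    continuous_snd.continuousOn).Icc_subset (mem_image_of_mem _ ha) (mem_image_of_mem _ hb) hy
  exact ⟨z.1, hz⟩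

/-- If the boundary point `g` is the last point of `Q` below height `h` on its null curve
`u = const`, then on the neighbouring null curves of larger `u` the boundary lies below any
height above `g`. -/
theorem exists_boundary_lt {g : ℝ × ℝ} {h η : ℝ} (hg : g ∈ M.S ∪ M.Γ) (hη : 0 < η)
    (hlast : ∀ w, (g.1, w) ∈ M.Q → w ≤ h → w ≤ g.2) :
    ∃ u₁ > g.1, ∀ u b, g.1 < u → u < u₁ → (u, b) ∈ M.S ∪ M.Γ → b ≤ h → b < g.2 + η := by
  have hgQ : g ∈ M.Q := hg.elim (fun h => M.S_subset h) fun h => M.Γ_subset h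
  have hS : ∀ u b, g.1 < u → (u, b) ∈ M.S → b < g.2 + η := by
    intro u b hu hb
    by_contra! hcon
    have := M.S_past _ hb g hgQ ⟨hu.le, by simp only; linarith⟩
    exact hu.ne (congrArg Prod.fst this)
  by_cases hgΓ : g ∈ M.Γ
  · by_cases hex : ∃ z ∈ M.Γ, g.2 + η ≤ z.2
    · obtain ⟨z, hz, hzη⟩ := hex
      -- A central point at half the allowed height: the centre stays below it for all smaller `u`.
      obtain ⟨x, hx⟩ := exists_snd_of_mem_Γ (y := g.2 + η / 2) hgΓ hz
        ⟨by linarith, by linarith⟩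
      have hgx : g.1 < x := by
        rcases M.Γ_timelike _ hgΓ _ hx (fun e => by
          have := congrArg Prod.snd e; simp only at this; linarith) with h | h
        · exact h.1
        · have := h.2; simp only at this; linarith
      refine ⟨x, hgx, fun u b hu hux hb _ => hb.elim (hS u b hu) fun hbΓ => ?_⟩
      rcases M.Γ_timelike _ hbΓ _ hx (fun e => hux.ne (congrArg Prod.fst e)) with h | h
      · have := h.2; simp only at this; linarith
      · exact absurd h.1 (not_lt.2 hux.le)
    · push Not at hex
      exact ⟨g.1 + 1, by linarith, fun u b _ _ hb _ => hb.elim (hS u b ‹_›) fun hbΓ =>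
        hex _ hbΓ⟩
  · have hgS : g ∈ M.S := hg.resolve_right hgΓ
    obtain ⟨o, ho⟩ := M.S_inter_Γ
    have hoS : o ∈ M.S := (ho.symm ▸ mem_singleton o : o ∈ M.S ∩ M.Γ).1
    have hoΓ : o ∈ M.Γ := (ho.symm ▸ mem_singleton o : o ∈ M.S ∩ M.Γ).2
    -- `o` is the corner of `S` and `Γ`. Before `o` no central point exists, as it would lie in the
    -- past of `o`; after `o` a central point at larger `u` forces the centre across `u = g.1` in
    -- the past of `g`.
    rcases lt_or_ge g.1 o.1 with hgo | hgo
    · refine ⟨o.1, hgo, fun u b hu huo hb _ => hb.elim (hS u b hu) fun hbΓ => ?_⟩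
      exfalso
      rcases M.Γ_timelike _ hbΓ _ hoΓ (fun e => huo.ne (congrArg Prod.fst e)) with h | h
      · exact huo.ne (congrArg Prod.fst (M.S_past o hoS _ (M.Γ_subset hbΓ) ⟨h.1.le, h.2.le⟩))
      · exact lt_asymm h.1 huo
    · refine ⟨g.1 + 1, by linarith, fun u b hu _ hb hbh => hb.elim (hS u b hu) fun hbΓ => ?_⟩
      exfalso
      obtain ⟨y, hy⟩ := exists_fst_of_mem_Γ hoΓ hbΓ ⟨hgo, hu.le⟩
      have hyb : y ≤ h := by
        rcases M.Γ_timelike _ hy _ hbΓ (fun e => hu.ne (congrArg Prod.fst e)) with h | h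
        · have := h.2; simp only at this; linarith
        · exact absurd h.1 (not_lt.2 hu.le)
      have := M.S_past g hgS _ (M.Γ_subset hy) ⟨le_rfl, hlast y (M.Γ_subset hy) hyb⟩
      exact hgΓ (this ▸ hy)

/-- Points of `Q` in the past of a first singularity come arbitrarily close to it. -/
theorem IsFirstSingularity.exists_mem_past (hp : M.IsFirstSingularity p) (hX : M.Generates X p)
    {δ : ℝ} (hδ0 : 0 < δ) (hδ : Disjoint (Metric.ball p δ) (M.S ∪ M.Γ)) :
    ∃ q ∈ M.Q, q ∈ Metric.ball p δ ∧ q ≤ p := by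
  by_contra! hno
  -- From a point with `u ≤ p.1` the null line `u = const` descends through the ball inside `Q`, and
  -- so enters the past of `p`.
  have hright : ∀ q ∈ M.Q, q ∈ Metric.ball p δ → p.1 < q.1 := by
    intro q hq hb
    by_contra! h
    obtain ⟨b, hbδ, -, hQ⟩ := vertical_mem hδ hq hb
    have hb' := mem_ball_iff.1 hb
    rcases le_total q.2 p.2 with h2 | h2
    · exact hno q hq hb ⟨h, h2⟩
    · exact hno (q.1, p.2) (hQ _ ⟨by linarith, h2⟩)
        (mem_ball_iff.2 ⟨hb'.1, by simpa using hδ0⟩) ⟨h, le_rfl⟩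
  obtain ⟨b, hb, hbQ⟩ := hX.exists_vertical hp.notMem
  -- The last point of `Q` at or below `p` on `u = p.1` exists, lies on the boundary and is a
  -- definite distance below `p`; above it there is a gap.
  set W : Set ℝ := {w | w ≤ p.2 ∧ (p.1, w) ∈ M.Q} with hW
  have hWb : ∀ w ∈ W, w ≤ p.2 - δ := by
    intro w hw
    by_contra! h
    exact lt_irrefl _ (hright (p.1, w) hw.2 (mem_ball_iff.2 ⟨by simpa using hδ0, by
      rw [abs_lt]; constructor <;> simp only <;> linarith [hw.1]⟩))
  have hWne : W.Nonempty := ⟨b, hb.le, hbQ⟩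
  have hWbdd : BddAbove W := ⟨_, hWb⟩
  set w₀ := sSup W
  have hw₀ : w₀ ≤ p.2 - δ := csSup_le hWne hWb
  have hlast : ∀ w, (p.1, w) ∈ M.Q → w ≤ p.2 → w ≤ w₀ := fun w hw h => le_csSup hWbdd ⟨h, hw⟩
  have hgQ : (p.1, w₀) ∈ M.Q := by
    by_contra hg
    refine hg (hp.mem_of_mem_closure hX ⟨le_rfl, by simp only; linarith⟩ (fun e => ?_) ?_ ?_)
    · have := congrArg Prod.snd e
      simp only at this
      linarith
    · refine domainOfDependence_of_segment (mem_domainOfDependence_of_generates hp.notMem hX)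
        -- The segment can meet `X ⊆ Q` only at its lower end, and that end would then already be in
        -- `Q`.
        ⟨le_rfl, by simp only; linarith⟩ fun t ht hmem => ?_
      have e : p + t • ((p.1, w₀) - p) = (p.1, p.2 + t * (w₀ - p.2)) := by ext <;> simp
      rw [e] at hmem
      have h1 := hlast _ (hX.2.1 hmem) (by nlinarith [ht.1])
      have h2 : p.2 + t * (w₀ - p.2) = w₀ := le_antisymm h1 (by nlinarith [ht.2])
      rw [h2] at hmem
      exact hg (hX.2.1 hmem)
    · have hc : w₀ ∈ closure W := csSup_mem_closure hWne hWbdd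
      have := image_closure_subset_closure_image (f := fun w : ℝ => (p.1, w)) (by fun_prop)
        (mem_image_of_mem _ hc)
      refine closure_mono ?_ this
      rintro _ ⟨w, hw, rfl⟩
      exact ⟨⟨le_rfl, hlast w hw.2 hw.1⟩, hw.2⟩
  have hgSΓ : (p.1, w₀) ∈ M.S ∪ M.Γ := by
    by_contra h
    have hint : (p.1, w₀) ∈ interior M.Q := M.interior_eq ▸ ⟨hgQ, h⟩
    have hc : ContinuousAt (fun w : ℝ => (p.1, w)) w₀ := by fun_prop
    obtain ⟨η, hη, hball⟩ := Metric.mem_nhds_iff.1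
      (hc.preimage_mem_nhds (isOpen_interior.mem_nhds hint))
    have hmem : w₀ + min (η / 2) δ ∈ Metric.ball w₀ η := by
      rw [Metric.mem_ball, Real.dist_eq, add_sub_cancel_left, abs_of_pos (by positivity)]
      exact (min_le_left _ _).trans_lt (by linarith)
    have h1 := hlast _ (interior_subset (hball hmem)) (by linarith [min_le_right (η / 2) δ])
    have : 0 < min (η / 2) δ := by positivity
    linarith
  have hcw : ContinuousWithinAt M.r M.Q (p.1, w₀) := M.r_continuous _ hgQ
  obtain ⟨η, hη, hrη⟩ := Metric.mem_nhdsWithin_iff.1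
    (hcw.preimage_mem_nhdsWithin (Iio_mem_nhds (lt_add_one (M.r (p.1, w₀)))))
  -- Small enough that `r < r(p.1, w₀) + 1` on the part of `Q` within `θ` of the boundary point, and
  -- that heights up to `w₀ + θ` remain in the gap.
  set θ := min η (δ / 2) with hθ
  have hθ0 : 0 < θ := by positivity
  have hθη : θ ≤ η := min_le_left _ _
  have hθδ : θ ≤ δ / 2 := min_le_right _ _
  obtain ⟨u₁, hu₁, hbdry⟩ := exists_boundary_lt hgSΓ hθ0 (h := p.2) hlast
  simp only at hu₁ hbdry
  obtain ⟨q, hqQ, hqd⟩ := Metric.mem_closure_iff.1 hp.mem_closure (min θ (u₁ - p.1))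
    (lt_min hθ0 (by linarith))
  rw [dist_comm, Prod.dist_eq, max_lt_iff, Real.dist_eq, Real.dist_eq, abs_lt, abs_lt,
    lt_min_iff, lt_min_iff] at hqd
  have hqball : q ∈ Metric.ball p δ := by
    rw [mem_ball_iff, abs_lt, abs_lt]
    obtain ⟨⟨h1, h2⟩, h3, h4⟩ := hqd
    have := min_le_left θ (u₁ - p.1)
    refine ⟨⟨?_, ?_⟩, ?_, ?_⟩ <;> linarith
  have hpq := hright q hqQ hqball
  obtain ⟨c, hcδ, hcSΓ, hcQ⟩ := vertical_mem hδ hqQ hqball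
  have hc := hbdry q.1 c hpq (by linarith [hqd.1.2.2]) hcSΓ (by linarith)
  have hq2 : w₀ + θ ≤ q.2 := by
    have := hqd.2.1
    have := min_le_left θ (u₁ - p.1)
    linarith
  -- Two candidate heights suffice, since the timelike centre meets the line `u = q.1` at most once.
  obtain ⟨w, hw1, hw2, hwc, hwΓ⟩ : ∃ w, w₀ < w ∧ w < w₀ + θ ∧ c ≤ w ∧ (q.1, w) ∉ M.Γ := by
    obtain ⟨x, hx1, hx2⟩ := exists_between (max_lt hc (by linarith : w₀ < w₀ + θ))
    obtain ⟨y, hy1, hy2⟩ := exists_between hx2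
    have h1 := max_lt_iff.1 hx1
    by_cases hx : (q.1, x) ∈ M.Γ
    · refine ⟨y, by linarith, hy2, by linarith, fun hy => ?_⟩
      rcases M.Γ_timelike _ hx _ hy (fun e => hy1.ne (congrArg Prod.snd e)) with h | h <;>
        exact lt_irrefl _ h.1
    · exact ⟨x, h1.2, hx2, h1.1.le, hx⟩
  have hgap : ∀ w, w₀ < w → w < w₀ + θ → (p.1, w) ∉ M.Q := fun w h1 h2 h =>
    absurd (hlast w h (by linarith)) (not_le.2 h1)
  -- Followed to the past, this null line cannot cross the gap. It cannot end earlier on `S`, whose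
  -- past would contain the boundary point, nor at infinity, because `r` is bounded there.
  rcases M.constV_past (q.1, w) ⟨hcQ w ⟨hwc, by linarith⟩, hwΓ⟩ with
    ⟨a, ha, haS, haQ⟩ | ⟨a, ha, haQ, hlim, -⟩
  · simp only at ha haS haQ
    rcases le_or_gt a p.1 with h | h
    · exact hgap w hw1 hw2 (haQ p.1 ⟨h, hpq.le⟩).1
    · exact h.ne (congrArg Prod.fst (M.S_past _ haS _ hgQ ⟨h.le, hw1.le⟩))
  · simp only at ha haQ hlim
    rcases lt_or_ge a p.1 with h | h
    · exact hgap w hw1 hw2 (haQ p.1 ⟨h, hpq.le⟩).1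
    · obtain ⟨u, hur, hu⟩ := ((hlim.eventually_ge_atTop (M.r (p.1, w₀) + 1)).and
        (Ioc_mem_nhdsGT ha)).exists
      have hu' : (u, w) ∈ Metric.ball ((p.1, w₀) : ℝ × ℝ) η := by
        rw [mem_ball_iff, abs_lt, abs_lt]
        have := hqd.1.2.1
        refine ⟨⟨?_, ?_⟩, ?_, ?_⟩ <;> simp only <;> linarith [hu.1, hu.2]
      have := hrη ⟨hu', (haQ u hu).1⟩
      exact absurd hur (not_le.2 this)

/-- Moving a point `q ≤ p` of `Q` a little further into its past creates strict room below `p` in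
both coordinates, so all sufficiently small rectangles fit into the diamond. -/
theorem IsFirstSingularity.exists_admissible (hp : M.IsFirstSingularity p)
    (hpΓ : p ∉ closure M.Γ) : ∃ ε₀ > 0, ∀ ε, 0 < ε → ε ≤ ε₀ → M.Admissible p ε := by
  obtain ⟨X, hX⟩ := hp.generated
  obtain ⟨δ, hδ0, hδ, hδX⟩ := hp.exists_ball hpΓ hX
  obtain ⟨q, hq, hqb, hqp⟩ := hp.exists_mem_past hX hδ0 hδ
  have hopen : IsOpen (interior M.Q ∩ Metric.ball p δ) :=
    isOpen_interior.inter Metric.isOpen_ball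
  obtain ⟨η, hη, hsub⟩ := Metric.isOpen_iff.1 hopen q
    ⟨inter_ball_subset_interior hδ ⟨hq, hqb⟩, hqb⟩
  have hz : (q.1 - η / 2, q.2 - η / 2) ∈ Metric.ball q η := by
    rw [mem_ball_iff, abs_lt, abs_lt]
    refine ⟨⟨?_, ?_⟩, ?_, ?_⟩ <;> simp only <;> linarith
  have hzb := (hsub hz).2
  have hIcc := hp.Icc_subset hX hδ hδX (interior_subset (hsub hz).1) hzb
  have h1 : q.1 ≤ p.1 := hqp.1
  have h2 : q.2 ≤ p.2 := hqp.2
  refine ⟨η / 2, by positivity, fun ε hε hεη => ⟨hε, ?_⟩⟩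
  rw [pastNhd_eq p hε]
  rintro x ⟨⟨⟨hx1, hx2⟩, hxp⟩, hne⟩
  simp only at hx1 hx2
  have hzx : (q.1 - η / 2, q.2 - η / 2) ≤ x := ⟨by simp only; linarith, by simp only; linarith⟩
  have hxball : x ∈ Metric.ball p δ := by
    rw [mem_ball_iff, abs_lt, abs_lt] at hzb ⊢
    have h3 : x.1 ≤ p.1 := hxp.1
    have h4 : x.2 ≤ p.2 := hxp.2
    obtain ⟨⟨h5, -⟩, h6, -⟩ := hzb
    simp only at h5 h6
    refine ⟨⟨?_, ?_⟩, ?_, ?_⟩ <;> linarith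
  exact ⟨hIcc ⟨⟨hzx, hxp⟩, hne⟩, disjoint_left.1 hδ hxball⟩

end SymmetricSpacetime

/-! ### Monotonicity from the sign of a derivative. -/

theorem le_of_hasDerivAt_nonneg {f f' : ℝ → ℝ} {a b : ℝ} (hab : a ≤ b)
    (hd : ∀ x ∈ Icc a b, HasDerivAt f (f' x) x) (h0 : ∀ x ∈ Icc a b, 0 ≤ f' x) : f a ≤ f b := by
  refine monotoneOn_of_deriv_nonneg (convex_Icc a b)
    (fun x hx => (hd x hx).continuousAt.continuousWithinAt)
    (fun x hx => (hd x (interior_subset hx)).differentiableAt.differentiableWithinAt)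
    (fun x hx => ?_) (left_mem_Icc.2 hab) (right_mem_Icc.2 hab) hab
  rw [(hd x (interior_subset hx)).deriv]
  exact h0 x (interior_subset hx)

theorem le_of_hasDerivAt_nonpos {f f' : ℝ → ℝ} {a b : ℝ} (hab : a ≤ b)
    (hd : ∀ x ∈ Icc a b, HasDerivAt f (f' x) x) (h0 : ∀ x ∈ Icc a b, f' x ≤ 0) : f b ≤ f a := by
  have := le_of_hasDerivAt_nonneg hab (fun x hx => (hd x hx).fun_neg) fun x hx =>
    neg_nonneg.2 (h0 x hx)
  linarith

namespace SymmetricSpacetime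

variable {n : ℕ} {k C : ℝ} {M : SymmetricSpacetime n k C} {p q : ℝ × ℝ} {ε : ℝ}

/-! ### Regularity and signs -/

theorem contDiffAt_nu (hq : q ∈ M.Q \ M.Γ) : ContDiffAt ℝ 1 M.nu q :=
  contDiffAt_du (M.r_regular q hq)

theorem contDiffAt_lam (hq : q ∈ M.Q \ M.Γ) : ContDiffAt ℝ 1 M.lam q :=
  contDiffAt_dv (M.r_regular q hq)

theorem continuousAt_mass (hq : q ∈ M.Q \ M.Γ) : ContinuousAt M.mass q := by
  have h1 := (M.r_regular q hq).continuousAt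
  have h2 := (M.Ω_regular q hq).continuousAt
  have h3 := (contDiffAt_nu hq).continuousAt
  have h4 := (contDiffAt_lam hq).continuousAt
  have h5 : M.Ω q ^ 2 ≠ 0 := pow_ne_zero 2 (M.Ω_pos q hq).ne'
  unfold mass
  fun_prop (disch := exact h5)

theorem Tuv_ge_neg_sq (hq : q ∈ M.Q \ M.Γ) : -(M.Ω q ^ 2 * C) ≤ M.Tuv q := by
  have h := M.Tuv_ge q hq
  have e : |2 * metricUV M.Ω q| = M.Ω q ^ 2 := by
    rw [metricUV, mul_div_cancel₀ _ (two_ne_zero' ℝ), abs_neg, abs_of_nonneg (sq_nonneg _)]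
  rw [e] at h
  linarith

/-- `T_uu ≥ 0` makes `ν/Ω²` nonincreasing in `u`, so a negative initial sign persists. -/
theorem nu_neg_of_segment (hn : 2 ≤ n) {a : ℝ} (ha : a ≤ q.1)
    (hseg : ∀ u ∈ Icc a q.1, (u, q.2) ∈ M.Q \ M.Γ) (hν : M.nu (a, q.2) < 0) : M.nu q < 0 := by
  let f : ℝ → ℝ := fun u => M.nu (u, q.2) / M.Ω (u, q.2) ^ 2
  -- Beyond its initial point the line cannot meet `S`, because that initial point would lie in the
  -- past of `S`.
  have hint : ∀ u ∈ Ioo a q.1, (u, q.2) ∈ interior M.Q := by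
    intro u hu
    have hu' := hseg u ⟨hu.1.le, hu.2.le⟩
    rw [M.interior_eq]
    refine ⟨hu'.1, ?_⟩
    rintro (hS | hΓ)
    · exact hu.1.ne (congrArg Prod.fst
        (M.S_past _ hS _ (hseg a ⟨le_rfl, ha⟩).1 ⟨hu.1.le, le_rfl⟩))
    · exact hu'.2 hΓ
  have hanti : AntitoneOn f (Icc a q.1) := by
    refine antitoneOn_of_deriv_nonpos (convex_Icc _ _) ?_ ?_ ?_
    · intro u hu
      have hQ := hseg u hu
      have h1 : ContinuousAt (fun u => M.nu (u, q.2)) u :=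
        ContinuousAt.comp (f := fun u => (u, q.2)) (contDiffAt_nu hQ).continuousAt (by fun_prop)
      have h2 : ContinuousAt (fun u => M.Ω (u, q.2)) u :=
        ContinuousAt.comp (f := fun u => (u, q.2)) (M.Ω_regular _ hQ).continuousAt (by fun_prop)
      exact (h1.div (h2.pow 2) (pow_ne_zero 2 (M.Ω_pos _ hQ).ne')).continuousWithinAt
    · intro u hu
      rw [interior_Icc] at hu
      exact (M.hasDerivAt_nu_div_sq hn (hint u hu)).differentiableAt.differentiableWithinAt
    · intro u hu
      rw [interior_Icc] at hu
      rw [(M.hasDerivAt_nu_div_sq hn (hint u hu)).deriv]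
      have hQ := M.interior_subset_diff (hint u hu)
      have h1 := M.r_pos _ hQ
      have h2 := M.Tuu_nonneg _ hQ
      rw [neg_mul, neg_mul, neg_div]
      exact neg_nonpos.2 (by positivity)
  have hle := hanti (left_mem_Icc.2 ha) (right_mem_Icc.2 ha) ha
  have hq : q ∈ M.Q \ M.Γ := hseg q.1 ⟨ha, le_rfl⟩
  have h1 : f a < 0 := div_neg_of_neg_of_pos hν (pow_pos (M.Ω_pos _ (hseg a ⟨le_rfl, ha⟩)) 2)
  have h2 : M.nu q / M.Ω q ^ 2 < 0 := hle.trans_lt h1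
  have h3 := pow_pos (M.Ω_pos q hq) 2
  by_contra! h
  exact absurd h2 (not_lt.2 (by positivity))

/-- `∂r/∂u` is negative off the centre. -/
theorem nu_neg (hn : 2 ≤ n) (hq : q ∈ M.Q \ M.Γ) : M.nu q < 0 := by
  rcases M.constV_past q hq with ⟨a, ha, haS, hseg⟩ | ⟨a, ha, hseg, -, hν⟩
  · exact nu_neg_of_segment hn ha hseg (M.nu_neg_S _ ⟨haS, (hseg a ⟨le_rfl, ha⟩).2⟩)
  · obtain ⟨b, hb, hab⟩ := (hν.and (Ioc_mem_nhdsGT ha)).exists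
    exact nu_neg_of_segment hn hab.2 (fun u hu => hseg u ⟨hab.1.trans_le hu.1, hu.2⟩) hb

/-! ### Geometry of admissible neighbourhoods -/

namespace Admissible

variable (h : M.Admissible p ε)
include h

theorem subset_interior : pastNhd p ε ⊆ interior M.Q := M.interior_eq ▸ h.2

theorem subset_diff : pastNhd p ε ⊆ M.Q \ M.Γ :=
  h.subset_interior.trans M.interior_subset_diff

theorem mem_iff : q ∈ pastNhd p ε ↔
    (p.1 - ε ≤ q.1 ∧ p.2 - ε ≤ q.2) ∧ (q.1 ≤ p.1 ∧ q.2 ≤ p.2) ∧ q ≠ p := by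
  rw [pastNhd_eq p h.1]
  exact and_assoc

theorem segment_u (hq : q ∈ pastNhd p ε) {u : ℝ} (hu : u ∈ Icc (p.1 - ε) q.1) :
    (u, q.2) ∈ pastNhd p ε := by
  rw [h.mem_iff] at hq ⊢
  refine ⟨⟨hu.1, hq.1.2⟩, ⟨hu.2.trans hq.2.1.1, hq.2.1.2⟩, fun e => hq.2.2 ?_⟩
  rw [Prod.ext_iff] at e ⊢
  exact ⟨le_antisymm hq.2.1.1 (e.1 ▸ hu.2), e.2⟩

theorem segment_v (hq : q ∈ pastNhd p ε) {v : ℝ} (hv : v ∈ Icc (p.2 - ε) q.2) :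
    (q.1, v) ∈ pastNhd p ε := by
  rw [h.mem_iff] at hq ⊢
  refine ⟨⟨hq.1.1, hv.1⟩, ⟨hq.2.1.1, hv.2.trans hq.2.1.2⟩, fun e => hq.2.2 ?_⟩
  rw [Prod.ext_iff] at e ⊢
  exact ⟨e.1, le_antisymm hq.2.1.2 (e.2 ▸ hv.2)⟩

theorem fst_mem (hq : q ∈ pastNhd p ε) : p.1 - ε ≤ q.1 := (h.mem_iff.1 hq).1.1

theorem snd_mem (hq : q ∈ pastNhd p ε) : p.2 - ε ≤ q.2 := (h.mem_iff.1 hq).1.2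

theorem left_mem (hq : q ∈ pastNhd p ε) : (p.1 - ε, q.2) ∈ nullCorner p ε :=
  Or.inl ⟨rfl, (h.mem_iff.1 hq).1.2, (h.mem_iff.1 hq).2.1.2⟩

theorem bottom_mem (hq : q ∈ pastNhd p ε) : (q.1, p.2 - ε) ∈ nullCorner p ε :=
  Or.inr ⟨⟨(h.mem_iff.1 hq).1.1, (h.mem_iff.1 hq).2.1.1⟩, rfl⟩

theorem exists_bound_corner {f : ℝ × ℝ → ℝ} (hf : ∀ q ∈ M.Q \ M.Γ, ContinuousAt f q) :
    ∃ B > 0, ∀ q ∈ nullCorner p ε, |f q| ≤ B := by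
  obtain ⟨B, hB⟩ := (isCompact_nullCorner p ε).exists_bound_of_continuousOn
    (f := f) fun q hq => (hf q (h.nullCorner_subset hq)).continuousWithinAt
  exact ⟨max B 1, by positivity, fun q hq => (hB q hq).trans (le_max_left _ _)⟩

theorem monotone_v {f f' : ℝ × ℝ → ℝ}
    (hd : ∀ q ∈ pastNhd p ε, HasDerivAt (fun v => f (q.1, v)) (f' q) q.2)
    (h0 : ∀ q ∈ pastNhd p ε, 0 ≤ f' q) (hq : q ∈ pastNhd p ε) : f (q.1, p.2 - ε) ≤ f q :=
  le_of_hasDerivAt_nonneg (f := fun v => f (q.1, v)) (f' := fun v => f' (q.1, v)) (h.snd_mem hq)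
    (fun _ hv => hd _ (h.segment_v hq hv)) fun _ hv => h0 _ (h.segment_v hq hv)

theorem antitone_u {f f' : ℝ × ℝ → ℝ}
    (hd : ∀ q ∈ pastNhd p ε, HasDerivAt (fun u => f (u, q.2)) (f' q) q.1)
    (h0 : ∀ q ∈ pastNhd p ε, f' q ≤ 0) (hq : q ∈ pastNhd p ε) : f q ≤ f (p.1 - ε, q.2) :=
  le_of_hasDerivAt_nonpos (f := fun u => f (u, q.2)) (f' := fun u => f' (u, q.2)) (h.fst_mem hq)
    (fun _ hu => hd _ (h.segment_u hq hu)) fun _ hu => h0 _ (h.segment_u hq hu)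

omit h in
theorem hasDerivAt_r_u (hq : q ∈ M.Q \ M.Γ) : HasDerivAt (fun u => M.r (u, q.2)) (M.nu q) q.1 :=
  hasDerivAt_du ((M.r_regular q hq).differentiableAt (by simp))

omit h in
theorem hasDerivAt_r_v (hq : q ∈ M.Q \ M.Γ) : HasDerivAt (fun v => M.r (q.1, v)) (M.lam q) q.2 :=
  hasDerivAt_dv ((M.r_regular q hq).differentiableAt (by simp))

omit h in
theorem hasDerivAt_nu_v (hq : q ∈ M.Q \ M.Γ) :
    HasDerivAt (fun v => M.nu (q.1, v)) (dv M.nu q) q.2 :=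
  hasDerivAt_dv ((contDiffAt_nu hq).differentiableAt (by simp))

/-! ### Bounds in the absence of trapped points -/

variable (hn : 2 ≤ n) (hlam : ∀ q ∈ pastNhd p ε, 0 ≤ M.lam q)
include hn hlam

/-- `r` grows in `v` from the bottom edge and decreases in `u` from the left edge. -/
theorem exists_r_bounds : ∃ r₀ > 0, ∃ R > 0, ∀ q ∈ pastNhd p ε, r₀ ≤ M.r q ∧ M.r q ≤ R := by
  obtain ⟨R, hR, hR'⟩ := h.exists_bound_corner (f := M.r) fun q hq =>
    (M.r_regular q hq).continuousAt
  obtain ⟨B, hB, hB'⟩ := h.exists_bound_corner (f := fun q => (M.r q)⁻¹) fun q hq =>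
    (M.r_regular q hq).continuousAt.inv₀ (M.r_pos q hq).ne'
  refine ⟨B⁻¹, inv_pos.2 hB, R, hR, fun q hq => ⟨?_, ?_⟩⟩
  · have h1 := h.monotone_v (f := M.r) (fun z hz => hasDerivAt_r_v (h.subset_diff hz)) hlam hq
    have h2 := hB' _ (h.bottom_mem hq)
    have h3 := M.r_pos _ (h.nullCorner_subset (h.bottom_mem hq))
    rw [abs_of_pos (inv_pos.2 h3)] at h2
    exact (inv_le_of_inv_le₀ h3 h2).trans h1
  · have h1 := h.antitone_u (f := M.r) (fun z hz => hasDerivAt_r_u (h.subset_diff hz))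
      (fun z hz => (nu_neg hn (h.subset_diff hz)).le) hq
    exact h1.trans ((le_abs_self _).trans (hR' _ (h.left_mem hq)))

/-- Adding `c r^(n+1)` replaces `T_uv` by `T_uv + CΩ² ≥ 0` in both derivatives of the mass. The sum
is therefore bounded above by the left edge and below by the bottom edge. -/
theorem exists_mass_bound (hC : 0 < C) : ∃ B > 0, ∀ q ∈ pastNhd p ε, |M.mass q| ≤ B := by
  obtain ⟨r₀, hr₀, R, hR, hr⟩ := h.exists_r_bounds hn hlam
  have hn0 : (0 : ℝ) < n := by positivity
  -- Chosen so that `c (n + 1) = 4C/n`, the prefactor of the mass derivatives.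
  set c : ℝ := 4 * C / (n * (n + 1)) with hc
  have hc0 : 0 < c := by positivity
  obtain ⟨B, hB, hB'⟩ := h.exists_bound_corner (f := fun q => M.mass q + c * M.r q ^ (n + 1))
    fun q hq => (continuousAt_mass hq).add
      (((M.r_regular q hq).continuousAt.pow _).const_mul c)
  have hcn : c * (n + 1) = 4 * C / n := by
    rw [hc]; field_simp
  refine ⟨B + c * R ^ (n + 1), by positivity, fun q hq => ?_⟩
  have hup := h.antitone_u (f := fun q => M.mass q + c * M.r q ^ (n + 1))
    (fun z hz => (M.hasDerivAt_mass_u hn (h.subset_interior hz)).fun_add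
      (((hasDerivAt_r_u (h.subset_diff hz)).fun_pow (n + 1)).const_mul c)) (fun z hz => ?_) hq
  rotate_left
  · have hz' := h.subset_diff hz
    have h1 := M.r_pos z hz'
    have h2 := M.Ω_pos z hz'
    have e : 4 * M.r z ^ n / (n * M.Ω z ^ 2) * (M.nu z * M.Tuv z - M.lam z * M.Tuu z) +
        c * (((n + 1 : ℕ) : ℝ) * M.r (z.1, z.2) ^ (n + 1 - 1) * M.nu z)
        = 4 * M.r z ^ n / (n * M.Ω z ^ 2) *
          (M.nu z * (M.Tuv z + M.Ω z ^ 2 * C) - M.lam z * M.Tuu z) := by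
      rw [Nat.add_sub_cancel]
      push_cast
      rw [show c * ((n + 1) * M.r (z.1, z.2) ^ n * M.nu z)
        = c * (n + 1) * (M.r z ^ n * M.nu z) by simp only [Prod.mk.eta]; ring, hcn]
      field_simp
      ring
    rw [e]
    refine mul_nonpos_of_nonneg_of_nonpos (by positivity) ?_
    have h3 := mul_nonneg (hlam z hz) (M.Tuu_nonneg z hz')
    have h4 := mul_nonpos_of_nonpos_of_nonneg (nu_neg hn hz').le
      (by linarith [Tuv_ge_neg_sq hz'] : 0 ≤ M.Tuv z + M.Ω z ^ 2 * C)
    linarith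
  have hlow := h.monotone_v (f := fun q => M.mass q + c * M.r q ^ (n + 1))
    (fun z hz => (M.hasDerivAt_mass_v hn (h.subset_interior hz)).fun_add
      (((hasDerivAt_r_v (h.subset_diff hz)).fun_pow (n + 1)).const_mul c)) (fun z hz => ?_) hq
  rotate_left
  · have hz' := h.subset_diff hz
    have h1 := M.r_pos z hz'
    have h2 := M.Ω_pos z hz'
    have e : 4 * M.r z ^ n / (n * M.Ω z ^ 2) * (M.lam z * M.Tuv z - M.nu z * M.Tvv z) +
        c * (((n + 1 : ℕ) : ℝ) * M.r (z.1, z.2) ^ (n + 1 - 1) * M.lam z)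
        = 4 * M.r z ^ n / (n * M.Ω z ^ 2) *
          (M.lam z * (M.Tuv z + M.Ω z ^ 2 * C) - M.nu z * M.Tvv z) := by
      rw [Nat.add_sub_cancel]
      push_cast
      rw [show c * ((n + 1) * M.r (z.1, z.2) ^ n * M.lam z)
        = c * (n + 1) * (M.r z ^ n * M.lam z) by simp only [Prod.mk.eta]; ring, hcn]
      field_simp
      ring
    rw [e]
    refine mul_nonneg (by positivity) ?_
    have h3 := mul_nonpos_of_nonpos_of_nonneg (nu_neg hn hz').le (M.Tvv_nonneg z hz')
    have h4 := mul_nonneg (hlam z hz)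
      (by linarith [Tuv_ge_neg_sq hz'] : 0 ≤ M.Tuv z + M.Ω z ^ 2 * C)
    linarith
  have h1 := (abs_le.1 (hB' _ (h.left_mem hq))).2
  have h2 := (abs_le.1 (hB' _ (h.bottom_mem hq))).1
  have h3 : c * M.r q ^ (n + 1) ≤ c * R ^ (n + 1) := by
    have := (M.r_pos q (h.subset_diff hq)).le
    gcongr
    exact (hr q hq).2
  have h4 : 0 ≤ c * M.r q ^ (n + 1) := by
    have := (M.r_pos q (h.subset_diff hq)).le
    positivity
  have h5 : 0 ≤ c * R ^ (n + 1) := by positivity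
  rw [abs_le]
  constructor <;> linarith

-- Since `ν/Ω²` is nonincreasing in `u`, it stays below its negative values on the left edge.
omit hlam in
theorem exists_sq_le_nu : ∃ K > 0, ∀ q ∈ pastNhd p ε, M.Ω q ^ 2 ≤ K * -M.nu q := by
  obtain ⟨K, hK, hK'⟩ := h.exists_bound_corner (f := fun q => M.Ω q ^ 2 / M.nu q) fun q hq =>
    ((M.Ω_regular q hq).continuousAt.pow 2).div (contDiffAt_nu hq).continuousAt (nu_neg hn hq).ne
  refine ⟨K, hK, fun q hq => ?_⟩
  have h1 := h.antitone_u (f := fun q => M.nu q / M.Ω q ^ 2)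
    (fun z hz => M.hasDerivAt_nu_div_sq hn (h.subset_interior hz)) (fun z hz => ?_) hq
  rotate_left
  · have := M.r_pos _ (h.subset_diff hz)
    have := M.Tuu_nonneg _ (h.subset_diff hz)
    rw [neg_mul, neg_mul, neg_div]
    exact neg_nonpos.2 (by positivity)
  have hq' := h.subset_diff hq
  have hl := h.nullCorner_subset (h.left_mem hq)
  have h2 := (abs_le.1 (hK' _ (h.left_mem hq))).1
  have h3 := nu_neg hn hl
  have h4 := pow_pos (M.Ω_pos _ hl) 2
  have h5 := pow_pos (M.Ω_pos _ hq') 2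
  have h6 : M.Ω (p.1 - ε, q.2) ^ 2 ≤ K * -M.nu (p.1 - ε, q.2) := by
    rw [le_div_iff_of_neg h3] at h2
    linarith
  have h7 : M.nu (p.1 - ε, q.2) / M.Ω (p.1 - ε, q.2) ^ 2 ≤ -K⁻¹ := by
    rw [div_le_iff₀ h4]
    have := mul_le_mul_of_nonneg_left h6 (inv_pos.2 hK).le
    rw [← mul_assoc, inv_mul_cancel₀ hK.ne'] at this
    linarith
  have h8 := h1.trans h7
  rw [div_le_iff₀ h5] at h8
  have := mul_le_mul_of_nonneg_left h8 hK.le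
  rw [neg_mul, mul_neg, ← mul_assoc, mul_inv_cancel₀ hK.ne'] at this
  linarith

end Admissible
end SymmetricSpacetime

namespace SymmetricSpacetime

variable {n : ℕ} {k C : ℝ} {M : SymmetricSpacetime n k C} {p q : ℝ × ℝ} {ε : ℝ}

namespace Admissible

variable (h : M.Admissible p ε) (hn : 2 ≤ n) (hlam : ∀ q ∈ pastNhd p ε, 0 ≤ M.lam q)
include h hn hlam

theorem exists_massRatio_bound (hC : 0 < C) :
    ∃ A > 0, ∀ q ∈ pastNhd p ε, |k + 4 * M.nu q * M.lam q / M.Ω q ^ 2| ≤ A := by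
  obtain ⟨r₀, hr₀, R, hR, hr⟩ := h.exists_r_bounds hn hlam
  obtain ⟨B, hB, hm⟩ := h.exists_mass_bound hn hlam hC
  refine ⟨2 * B / r₀ ^ (n - 1), by positivity, fun q hq => ?_⟩
  rw [le_div_iff₀ (by positivity)]
  have h1 := hm q hq
  have h2 := M.r_pos q (h.subset_diff hq)
  rw [mass, abs_mul, abs_of_nonneg (by positivity)] at h1
  have h3 : r₀ ^ (n - 1) ≤ M.r q ^ (n - 1) := by
    gcongr
    exact (hr q hq).1
  have := mul_le_mul_of_nonneg_left h3 (abs_nonneg (k + 4 * M.nu q * M.lam q / M.Ω q ^ 2))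
  linarith

/-- The bounded mass ratio controls `|ν|λ/Ω²`, and `Ω²/|ν|` is bounded. -/
theorem exists_lam_bound (hC : 0 < C) : ∃ B > 0, ∀ q ∈ pastNhd p ε, M.lam q ≤ B := by
  obtain ⟨A, hA, hφ⟩ := h.exists_massRatio_bound hn hlam hC
  obtain ⟨K, hK, hκ⟩ := h.exists_sq_le_nu hn
  refine ⟨K * (|k| + A) / 4, by positivity, fun q hq => ?_⟩
  have hq' := h.subset_diff hq
  have h1 := nu_neg hn hq'
  have h2 := pow_pos (M.Ω_pos q hq') 2
  have h3 := (abs_le.1 (hφ q hq)).1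
  have h4 : 4 * M.nu q * M.lam q / M.Ω q ^ 2 * M.Ω q ^ 2 = 4 * M.nu q * M.lam q :=
    div_mul_cancel₀ _ h2.ne'
  have h5 : -(|k| + A) ≤ 4 * M.nu q * M.lam q / M.Ω q ^ 2 := by linarith [le_abs_self k]
  have h6 := mul_le_mul_of_nonneg_right h5 h2.le
  rw [h4] at h6
  have h7 := mul_le_mul_of_nonneg_left (hκ q hq) (by positivity : 0 ≤ |k| + A)
  have h8 : M.lam q * (4 * -M.nu q) ≤ K * (|k| + A) / 4 * (4 * -M.nu q) := by linarith
  exact le_of_mul_le_mul_right h8 (by linarith)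

omit hlam in
theorem dv_nu_eq (hq : q ∈ pastNhd p ε) : dv M.nu q = 2 / n * M.r q * M.Tuv q
    - (n - 1) * M.Ω q ^ 2 / (4 * M.r q) * (k + 4 * M.nu q * M.lam q / M.Ω q ^ 2) := by
  have hq' := h.subset_diff hq
  have h1 := (M.r_pos q hq').ne'
  have h2 := (M.Ω_pos q hq').ne'
  have hn0 : (n : ℝ) ≠ 0 := by positivity
  have h3 := M.mul_dv_nu hn (h.subset_interior hq)
  field_simp at h3 ⊢
  linear_combination h3

/-- The coefficient of the zeroth order term in the wave equation for `r` is bounded. -/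
theorem exists_waveCoeff_bound (hC : 0 < C) : ∃ D > 0, ∀ q ∈ pastNhd p ε,
    |(n - 1) * M.Ω q ^ 2 / (4 * M.r q) * (k + 4 * M.nu q * M.lam q / M.Ω q ^ 2)|
      ≤ D * -M.nu q := by
  obtain ⟨r₀, hr₀, R, hR, hr⟩ := h.exists_r_bounds hn hlam
  obtain ⟨A, hA, hφ⟩ := h.exists_massRatio_bound hn hlam hC
  obtain ⟨K, hK, hκ⟩ := h.exists_sq_le_nu hn
  have hn2 : (2 : ℝ) ≤ n := by exact_mod_cast hn
  have hn1 : (0 : ℝ) < n - 1 := by linarith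
  refine ⟨(n - 1) * K / (4 * r₀) * A, by positivity, fun q hq => ?_⟩
  have hq' := h.subset_diff hq
  have h1 := nu_neg hn hq'
  have h2 := M.r_pos q hq'
  have hκq := hκ q hq
  rw [abs_mul, abs_of_nonneg (by positivity)]
  calc _ ≤ (n - 1) * (K * -M.nu q) / (4 * r₀) * A := by
        have : 0 ≤ K * -M.nu q := mul_nonneg hK.le (by linarith)
        gcongr
        · exact (hr q hq).1
        · exact hφ q hq
    _ = _ := by ring

/-- Grönwall in `v`: the wave equation gives `∂_v ν ≥ Lν`, so `ν e^(-Lv)` is nondecreasing. As `ν <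
0`, the lower bound on `T_uv` is enough. -/
theorem exists_nu_bound (hC : 0 < C) : ∃ B > 0, ∀ q ∈ pastNhd p ε, -M.nu q ≤ B := by
  obtain ⟨r₀, hr₀, R, hR, hr⟩ := h.exists_r_bounds hn hlam
  obtain ⟨K, hK, hκ⟩ := h.exists_sq_le_nu hn
  obtain ⟨D, hD, hw⟩ := h.exists_waveCoeff_bound hn hlam hC
  obtain ⟨B, hB, hB'⟩ := h.exists_bound_corner (f := M.nu) fun q hq => (contDiffAt_nu hq).continuousAt
  have hn0 : (0 : ℝ) < n := by positivity
  -- The first summand pays for the negative part of `T_uv`, via `Ω² ≤ K|ν|`; `D` pays for the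
  -- remaining term of the wave equation.
  set L := 2 / n * R * C * K + D with hL
  have hL0 : 0 < L := by positivity
  refine ⟨B * Real.exp (L * ε), by positivity, fun q hq => ?_⟩
  have hmono := h.monotone_v (f := fun q => M.nu q * Real.exp (-(L * q.2)))
    (f' := fun q => dv M.nu q * Real.exp (-(L * q.2))
      + M.nu q * (Real.exp (-(L * q.2)) * -L)) (fun z hz => ?_) (fun z hz => ?_) hq
  rotate_left
  · have hlin : HasDerivAt (fun v : ℝ => -(L * v)) (-L) z.2 := by
      simpa using ((hasDerivAt_id z.2).const_mul L).fun_neg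
    exact (hasDerivAt_nu_v (h.subset_diff hz)).fun_mul hlin.exp
  · have hz' := h.subset_diff hz
    have h1 := nu_neg hn hz'
    have h2 := (abs_le.1 (hw z hz)).2
    have h3 := Tuv_ge_neg_sq hz'
    have h4 := M.r_pos z hz'
    have h5 : 2 / n * M.r z * -(M.Ω z ^ 2 * C) ≤ 2 / n * M.r z * M.Tuv z := by gcongr
    have h6 : 2 / n * M.r z * (M.Ω z ^ 2 * C) ≤ 2 / n * R * ((K * -M.nu z) * C) := by
      have := hκ z hz
      gcongr
      exact (hr z hz).2
    have h7 : 0 ≤ dv M.nu z - L * M.nu z := by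
      rw [h.dv_nu_eq hn hz, hL]
      linarith
    have := mul_nonneg h7 (Real.exp_pos (-(L * z.2))).le
    linarith
  simp only at hmono
  have h1 := (abs_le.1 (hB' _ (h.bottom_mem hq))).1
  have h2 : -B * Real.exp (-(L * (p.2 - ε))) ≤ M.nu q * Real.exp (-(L * q.2)) :=
    (mul_le_mul_of_nonneg_right h1 (Real.exp_pos _).le).trans hmono
  have h3 := mul_le_mul_of_nonneg_right h2 (Real.exp_pos (L * q.2)).le
  rw [mul_assoc, mul_assoc, ← Real.exp_add, ← Real.exp_add, neg_add_cancel, Real.exp_zero,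
    mul_one] at h3
  have h4 : Real.exp (-(L * (p.2 - ε)) + L * q.2) ≤ Real.exp (L * ε) := by
    rw [Real.exp_le_exp]
    have := mul_le_mul_of_nonneg_left (h.mem_iff.1 hq).2.1.2 hL0.le
    linarith
  have h5 := mul_le_mul_of_nonneg_left h4 hB.le
  linarith

theorem exists_Ω_bound (hC : 0 < C) : ∃ B > 0, ∀ q ∈ pastNhd p ε, M.Ω q ≤ B := by
  obtain ⟨K, hK, hκ⟩ := h.exists_sq_le_nu hn
  obtain ⟨N, hN, hν⟩ := h.exists_nu_bound hn hlam hC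
  refine ⟨1 + K * N, by positivity, fun q hq => ?_⟩
  have h1 := (hκ q hq).trans (mul_le_mul_of_nonneg_left (hν q hq) hK.le)
  nlinarith [sq_nonneg (M.Ω q - 1)]

theorem exists_bounds (hC : 0 < C) : ∃ r₀ > 0, ∃ B : ℝ, ∀ q ∈ pastNhd p ε,
    |M.mass q| ≤ B ∧ r₀ ≤ M.r q ∧ M.r q ≤ B ∧ |M.nu q| ≤ B ∧ |M.lam q| ≤ B ∧ |M.Ω q| ≤ B := by
  obtain ⟨r₀, hr₀, R, hR, hr⟩ := h.exists_r_bounds hn hlam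
  obtain ⟨B₁, hB₁, h₁⟩ := h.exists_mass_bound hn hlam hC
  obtain ⟨B₂, hB₂, h₂⟩ := h.exists_nu_bound hn hlam hC
  obtain ⟨B₃, hB₃, h₃⟩ := h.exists_lam_bound hn hlam hC
  obtain ⟨B₄, hB₄, h₄⟩ := h.exists_Ω_bound hn hlam hC
  refine ⟨r₀, hr₀, R + B₁ + B₂ + B₃ + B₄, fun q hq => ?_⟩
  have hq' := h.subset_diff hq
  rw [abs_of_neg (nu_neg hn hq'), abs_of_nonneg (hlam q hq), abs_of_pos (M.Ω_pos q hq')]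
  have := h₁ q hq; have := h₂ q hq; have := h₃ q hq; have := h₄ q hq; have := hr q hq
  refine ⟨?_, this.1, ?_, ?_, ?_, ?_⟩ <;> linarith

omit hlam

/-! ### The regular region -/

variable {lam₀ : ℝ} (hlam₀ : 0 < lam₀) (hreg : ∀ q ∈ pastNhd p ε, lam₀ ≤ M.lam q)
include hlam₀ hreg

theorem exists_nu_le_sq (hC : 0 < C) : ∃ c > 0, ∀ q ∈ pastNhd p ε, c * -M.nu q ≤ M.Ω q ^ 2 := by
  obtain ⟨A, hA, hφ⟩ :=
    h.exists_massRatio_bound hn (fun q hq => hlam₀.le.trans (hreg q hq)) hC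
  refine ⟨4 * lam₀ / (|k| + A), by positivity, fun q hq => ?_⟩
  have hq' := h.subset_diff hq
  have h1 := nu_neg hn hq'
  have h2 := pow_pos (M.Ω_pos q hq') 2
  have h3 := (abs_le.1 (hφ q hq)).1
  have h4 : 4 * M.nu q * M.lam q / M.Ω q ^ 2 * M.Ω q ^ 2 = 4 * M.nu q * M.lam q :=
    div_mul_cancel₀ _ h2.ne'
  have h5 : -(|k| + A) ≤ 4 * M.nu q * M.lam q / M.Ω q ^ 2 := by linarith [le_abs_self k]
  have h6 := mul_le_mul_of_nonneg_right h5 h2.le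
  rw [h4] at h6
  have h7 := mul_le_mul_of_nonneg_right (hreg q hq) (by linarith : 0 ≤ -M.nu q)
  rw [div_mul_eq_mul_div, div_le_iff₀ (by positivity)]
  linarith

/-- `∂_v log|ν|` has the uncontrolled term `-(2/n) r T_uv/|ν|`. With `λ ≥ λ₀` and `Ω² ≤ K|ν|`, a
multiple of `∂_v m` compensates it, and `m` itself is bounded. -/
theorem exists_nu_lower_bound (hC : 0 < C) : ∃ ν₀ > 0, ∀ q ∈ pastNhd p ε, ν₀ ≤ -M.nu q := by
  have hlam : ∀ q ∈ pastNhd p ε, 0 ≤ M.lam q := fun q hq => hlam₀.le.trans (hreg q hq)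
  obtain ⟨r₀, hr₀, R, hR, hr⟩ := h.exists_r_bounds hn hlam
  obtain ⟨K, hK, hκ⟩ := h.exists_sq_le_nu hn
  obtain ⟨D, hD, hw⟩ := h.exists_waveCoeff_bound hn hlam hC
  obtain ⟨B, hB, hm⟩ := h.exists_mass_bound hn hlam hC
  obtain ⟨Λ, hΛ, hlamΛ⟩ := h.exists_lam_bound hn hlam hC
  obtain ⟨N, hN, hN'⟩ := h.exists_bound_corner (f := fun q => Real.log (-M.nu q)) fun q hq =>
    (contDiffAt_nu hq).continuousAt.neg.log (neg_ne_zero.2 (nu_neg hn hq).ne)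
  have hn0 : (0 : ℝ) < n := by positivity
  -- `β` is the share of `(T_uv + CΩ²)/|ν|` guaranteed in `∂_v m`; `α` scales it to cancel the bad
  -- term exactly, and `E` absorbs the bounded errors.
  set β := 4 * r₀ ^ n * lam₀ / (n * K) with hβ
  have hβ0 : 0 < β := by positivity
  set α := 2 / n * R / β with hα
  have hα0 : 0 < α := by positivity
  set E := D + α * (4 * R ^ n * Λ / n * C) with hE
  have hE0 : 0 < E := by positivity
  refine ⟨Real.exp (-(N + 2 * α * B + E * ε)), Real.exp_pos _, fun q hq => ?_⟩
  have hmono := h.monotone_v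
    (f := fun q => Real.log (-M.nu q) + α * M.mass q + E * q.2)
    (f' := fun q => -dv M.nu q / -M.nu q + α * (4 * M.r q ^ n / (n * M.Ω q ^ 2)
      * (M.lam q * M.Tuv q - M.nu q * M.Tvv q)) + E) (fun z hz => ?_) (fun z hz => ?_) hq
  rotate_left
  · have hlin : HasDerivAt (fun v : ℝ => E * v) E z.2 := by
      simpa using (hasDerivAt_id z.2).const_mul E
    exact (((hasDerivAt_nu_v (h.subset_diff hz)).fun_neg.log
      (by linarith [nu_neg hn (h.subset_diff hz)])).fun_add
      ((M.hasDerivAt_mass_v hn (h.subset_interior hz)).const_mul α)).fun_add hlin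
  · have hz' := h.subset_diff hz
    have h1 : 0 < -M.nu z := by linarith [nu_neg hn hz']
    have h2 := (abs_le.1 (hw z hz)).1
    have h4 := M.r_pos z hz'
    have hΩ := M.Ω_pos z hz'
    have hΩ2 := pow_pos hΩ 2
    set T := M.Tuv z + M.Ω z ^ 2 * C with hT
    have hT0 : 0 ≤ T := by linarith [Tuv_ge_neg_sq hz']
    have hvv := mul_nonneg h1.le (M.Tvv_nonneg z hz')
    have key1 : -(2 / n * R * (T / -M.nu z)) - D ≤ -dv M.nu z / -M.nu z := by
      rw [h.dv_nu_eq hn hz, le_div_iff₀ h1]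
      have e : (-(2 / n * R * (T / -M.nu z)) - D) * -M.nu z
          = -(2 / n * R * T) - D * -M.nu z := by
        have := (nu_neg hn hz').ne
        field_simp
        ring
      rw [e]
      have h5 : 2 / n * M.r z * M.Tuv z ≤ 2 / n * R * T := by
        have : M.Tuv z ≤ T := by rw [hT]; linarith [mul_nonneg hΩ2.le hC.le]
        calc _ ≤ 2 / n * M.r z * T := by gcongr
          _ ≤ _ := by gcongr; exact (hr z hz).2
      linarith
    have key2 : β * (T / -M.nu z) - 4 * R ^ n * Λ / n * C ≤ 4 * M.r z ^ n / (n * M.Ω z ^ 2)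
        * (M.lam z * M.Tuv z - M.nu z * M.Tvv z) := by
      have e : 4 * M.r z ^ n / (n * M.Ω z ^ 2) * (M.lam z * M.Tuv z - M.nu z * M.Tvv z)
          = 4 * M.r z ^ n * M.lam z / (n * M.Ω z ^ 2) * T
            + 4 * M.r z ^ n / (n * M.Ω z ^ 2) * (-M.nu z * M.Tvv z)
            - 4 * M.r z ^ n * M.lam z / n * C := by
        rw [hT]; field_simp; ring
      have h6 : β * (T / -M.nu z) ≤ 4 * M.r z ^ n * M.lam z / (n * M.Ω z ^ 2) * T := by
        have e2 : β * (T / -M.nu z) = 4 * r₀ ^ n * lam₀ / (n * (K * -M.nu z)) * T := by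
          rw [hβ]; field_simp
        rw [e2]
        have := hκ z hz
        have := hlam z hz
        gcongr
        · exact (hr z hz).1
        · exact hreg z hz
      have h7 : 0 ≤ 4 * M.r z ^ n / (n * M.Ω z ^ 2) * (-M.nu z * M.Tvv z) := by positivity
      have h8 : 4 * M.r z ^ n * M.lam z / n * C ≤ 4 * R ^ n * Λ / n * C := by
        have := hlam z hz
        gcongr
        · exact (hr z hz).2
        · exact hlamΛ z hz
      rw [e]
      linarith
    have key3 := mul_le_mul_of_nonneg_left key2 hα0.le
    have e3 : α * (β * (T / -M.nu z)) = 2 / n * R * (T / -M.nu z) := by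
      rw [hα]; field_simp
    rw [mul_sub, e3] at key3
    rw [hE]
    linarith
  simp only at hmono
  have h1 := (abs_le.1 (hN' _ (h.bottom_mem hq))).1
  have hb : (q.1, p.2 - ε) ∈ pastNhd p ε := h.segment_v hq ⟨le_rfl, h.snd_mem hq⟩
  have h2 := mul_le_mul_of_nonneg_left (abs_le.1 (hm _ hb)).1 hα0.le
  have h3 := mul_le_mul_of_nonneg_left (abs_le.1 (hm _ hq)).2 hα0.le
  have h4 := mul_le_mul_of_nonneg_left (h.mem_iff.1 hq).2.1.2 hE0.le
  rw [← Real.le_log_iff_exp_le (by linarith [nu_neg hn (h.subset_diff hq)])]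
  linarith

theorem exists_Ω_lower_bound (hC : 0 < C) : ∃ w > 0, ∀ q ∈ pastNhd p ε, w ≤ M.Ω q ^ 2 := by
  obtain ⟨c, hc, h₁⟩ := h.exists_nu_le_sq hn hlam₀ hreg hC
  obtain ⟨ν₀, hν₀, h₂⟩ := h.exists_nu_lower_bound hn hlam₀ hreg hC
  exact ⟨c * ν₀, by positivity, fun q hq =>
    (mul_le_mul_of_nonneg_left (h₂ q hq) hc.le).trans (h₁ q hq)⟩

theorem exists_regular_bounds (hC : 0 < C) : ∃ ν₀ > 0, ∃ B : ℝ, ∀ q ∈ pastNhd p ε,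
    ν₀ ≤ |M.nu q| ∧ |(M.Ω q)⁻¹| ≤ B := by
  obtain ⟨w, hw, h₁⟩ := h.exists_Ω_lower_bound hn hlam₀ hreg hC
  obtain ⟨ν₀, hν₀, h₂⟩ := h.exists_nu_lower_bound hn hlam₀ hreg hC
  refine ⟨ν₀, hν₀, 1 + w⁻¹, fun q hq => ⟨(h₂ q hq).trans (neg_le_abs _), ?_⟩⟩
  have hΩ := M.Ω_pos q (h.subset_diff hq)
  rw [abs_of_pos (inv_pos.2 hΩ)]
  have h3 : (M.Ω q ^ 2)⁻¹ ≤ w⁻¹ := inv_anti₀ hw (h₁ q hq)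
  rw [← inv_pow] at h3
  nlinarith [sq_nonneg ((M.Ω q)⁻¹ - 1)]

end Admissible
end SymmetricSpacetime

namespace SymmetricSpacetime

variable {n : ℕ} {k C : ℝ} {M : SymmetricSpacetime n k C} {p q : ℝ × ℝ} {ε : ℝ}

namespace Admissible

variable (h : M.Admissible p ε)
include h

/-! ### Integrability of the matter -/

/-- Only `|g|` needs to be integrable, which continuity provides; nothing is required of `f'` beyond
the domination. -/
theorem integral_v_le {f f' g : ℝ × ℝ → ℝ} (hg : ContinuousOn g (M.Q \ M.Γ))
    (hd : ∀ z ∈ pastNhd p ε, HasDerivAt (fun v => f (z.1, v)) (f' z) z.2)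
    (hle : ∀ z ∈ pastNhd p ε, |g z| ≤ f' z) (hq : q ∈ pastNhd p ε) :
    ∫ v in (p.2 - ε)..q.2, |g (q.1, v)| ≤ f q - f (q.1, p.2 - ε) := by
  have hseg : ∀ v ∈ Icc (p.2 - ε) q.2, (q.1, v) ∈ pastNhd p ε := fun v hv => h.segment_v hq hv
  refine intervalIntegral.integral_le_sub_of_hasDeriv_right_of_le
    (g := fun v => f (q.1, v)) (g' := fun v => f' (q.1, v)) (h.snd_mem hq)
    (fun v hv => (hd _ (hseg v hv)).continuousAt.continuousWithinAt)
    (fun v hv => (hd _ (hseg v (Ioo_subset_Icc_self hv))).hasDerivWithinAt) ?_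
    (fun v hv => hle _ (hseg v (Ioo_subset_Icc_self hv)))
  refine ContinuousOn.integrableOn_Icc (ContinuousOn.abs ?_)
  exact hg.comp (by fun_prop) fun v hv => h.subset_diff (hseg v hv)

theorem integral_u_le {f f' g : ℝ × ℝ → ℝ} (hg : ContinuousOn g (M.Q \ M.Γ))
    (hd : ∀ z ∈ pastNhd p ε, HasDerivAt (fun u => f (u, z.2)) (f' z) z.1)
    (hle : ∀ z ∈ pastNhd p ε, |g z| ≤ f' z) (hq : q ∈ pastNhd p ε) :
    ∫ u in (p.1 - ε)..q.1, |g (u, q.2)| ≤ f q - f (p.1 - ε, q.2) := by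
  have hseg : ∀ u ∈ Icc (p.1 - ε) q.1, (u, q.2) ∈ pastNhd p ε := fun u hu => h.segment_u hq hu
  refine intervalIntegral.integral_le_sub_of_hasDeriv_right_of_le
    (g := fun u => f (u, q.2)) (g' := fun u => f' (u, q.2)) (h.fst_mem hq)
    (fun u hu => (hd _ (hseg u hu)).continuousAt.continuousWithinAt)
    (fun u hu => (hd _ (hseg u (Ioo_subset_Icc_self hu))).hasDerivWithinAt) ?_
    (fun u hu => hle _ (hseg u (Ioo_subset_Icc_self hu)))
  refine ContinuousOn.integrableOn_Icc (ContinuousOn.abs ?_)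
  exact hg.comp (by fun_prop) fun u hu => h.subset_diff (hseg u hu)

omit h in
/-- Two nonnegative quantities are controlled by a weighted sum of them. -/
theorem le_and_le_of_weighted_sum {w w₀ x x₀ y y₀ S T : ℝ} (hw₀ : 0 < w₀) (hx₀ : 0 < x₀)
    (hy₀ : 0 < y₀) (hw : w₀ ≤ w) (hx : x₀ ≤ x) (hy : y₀ ≤ y) (hS : 0 ≤ S) (hT : 0 ≤ T) :
    S ≤ ((w₀ * x₀)⁻¹ + (w₀ * y₀)⁻¹) * (w * (x * S + y * T)) ∧
      T ≤ ((w₀ * x₀)⁻¹ + (w₀ * y₀)⁻¹) * (w * (x * S + y * T)) := by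
  have h1 : w₀ * x₀ * S + w₀ * y₀ * T ≤ w * (x * S + y * T) := by
    have : w * (x * S + y * T) = w * x * S + w * y * T := by ring
    have hw' := hw₀.le.trans hw
    rw [this]
    gcongr
  have ha : 0 < w₀ * x₀ := by positivity
  have hb : 0 < w₀ * y₀ := by positivity
  have h2 : ((w₀ * x₀)⁻¹ + (w₀ * y₀)⁻¹) * (w₀ * x₀ * S + w₀ * y₀ * T)
      ≤ ((w₀ * x₀)⁻¹ + (w₀ * y₀)⁻¹) * (w * (x * S + y * T)) :=
    mul_le_mul_of_nonneg_left h1 (by positivity)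
  have e : ((w₀ * x₀)⁻¹ + (w₀ * y₀)⁻¹) * (w₀ * x₀ * S + w₀ * y₀ * T)
      = S + T + ((w₀ * x₀)⁻¹ * (w₀ * y₀ * T) + (w₀ * y₀)⁻¹ * (w₀ * x₀ * S)) := by
    field_simp
    ring
  have h3 : 0 ≤ (w₀ * x₀)⁻¹ * (w₀ * y₀ * T) + (w₀ * y₀)⁻¹ * (w₀ * x₀ * S) := by positivity
  rw [e] at h2
  constructor <;> linarith

variable (hn : 2 ≤ n) {lam₀ : ℝ} (hlam₀ : 0 < lam₀) (hreg : ∀ q ∈ pastNhd p ε, lam₀ ≤ M.lam q)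
include hn hlam₀ hreg

/-- After the shift `T_uv + CΩ² ≥ 0`, `∂_v m` and `-∂_u m` are, up to bounded terms, sums of
nonnegative matter components with weights bounded away from zero. Hence they dominate each
component. -/
theorem exists_stress_le (hC : 0 < C) : ∃ α > 0, ∃ β > 0, ∀ z ∈ pastNhd p ε,
    (|M.Tuv z| ≤ α * (4 * M.r z ^ n / (n * M.Ω z ^ 2)
        * (M.lam z * M.Tuv z - M.nu z * M.Tvv z)) + β ∧
      |M.Tvv z| ≤ α * (4 * M.r z ^ n / (n * M.Ω z ^ 2)
        * (M.lam z * M.Tuv z - M.nu z * M.Tvv z)) + β) ∧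
    (|M.Tuv z| ≤ -α * (4 * M.r z ^ n / (n * M.Ω z ^ 2)
        * (M.nu z * M.Tuv z - M.lam z * M.Tuu z)) + β ∧
      |M.Tuu z| ≤ -α * (4 * M.r z ^ n / (n * M.Ω z ^ 2)
        * (M.nu z * M.Tuv z - M.lam z * M.Tuu z)) + β) := by
  have hlam : ∀ q ∈ pastNhd p ε, 0 ≤ M.lam q := fun q hq => hlam₀.le.trans (hreg q hq)
  obtain ⟨r₀, hr₀, R, hR, hr⟩ := h.exists_r_bounds hn hlam
  obtain ⟨N, hN, hνN⟩ := h.exists_nu_bound hn hlam hC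
  obtain ⟨ν₀, hν₀, hν⟩ := h.exists_nu_lower_bound hn hlam₀ hreg hC
  obtain ⟨Λ, hΛ, hlamΛ⟩ := h.exists_lam_bound hn hlam hC
  obtain ⟨G, hG, hΩG⟩ := h.exists_Ω_bound hn hlam hC
  have hn0 : (0 : ℝ) < n := by positivity
  set w₀ := 4 * r₀ ^ n / (n * G ^ 2) with hw₀
  have hw₀0 : 0 < w₀ := by positivity
  set α := (w₀ * lam₀)⁻¹ + (w₀ * ν₀)⁻¹ with hα
  have hα0 : 0 < α := by positivity
  refine ⟨α, hα0, α * (4 * R ^ n * (Λ + N) / n * C) + G ^ 2 * C, by positivity, fun z hz => ?_⟩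
  have hz' := h.subset_diff hz
  have h1 := M.r_pos z hz'
  have h2 := M.Ω_pos z hz'
  have h3 := nu_neg hn hz'
  set T := M.Tuv z + M.Ω z ^ 2 * C with hT
  have hT0 : 0 ≤ T := by linarith [Tuv_ge_neg_sq hz']
  have hsq : M.Ω z ^ 2 * C ≤ G ^ 2 * C := by
    gcongr
    exact hΩG z hz
  have hsq0 : 0 ≤ M.Ω z ^ 2 * C := by positivity
  have hTabs : |M.Tuv z| ≤ T + G ^ 2 * C := by
    rw [abs_le]
    constructor <;> linarith
  set w := 4 * M.r z ^ n / (n * M.Ω z ^ 2) with hw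
  have hww : w₀ ≤ w := by
    rw [hw₀, hw]
    gcongr
    · exact (hr z hz).1
    · exact hΩG z hz
  have e1 : w * (M.lam z * M.Tuv z - M.nu z * M.Tvv z)
      = w * (M.lam z * T + -M.nu z * M.Tvv z) - 4 * M.r z ^ n * M.lam z / n * C := by
    rw [hT, hw]; field_simp; ring
  have e2 : w * (M.nu z * M.Tuv z - M.lam z * M.Tuu z)
      = -(w * (M.lam z * M.Tuu z + -M.nu z * T)) + 4 * M.r z ^ n * -M.nu z / n * C := by
    rw [hT, hw]; field_simp; ring
  have b1 := le_and_le_of_weighted_sum hw₀0 hlam₀ hν₀ hww (hreg z hz) (hν z hz) hT0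
    (M.Tvv_nonneg z hz')
  have b2 := le_and_le_of_weighted_sum hw₀0 hlam₀ hν₀ hww (hreg z hz) (hν z hz)
    (M.Tuu_nonneg z hz') hT0
  have c1 : α * (4 * M.r z ^ n * M.lam z / n * C) ≤ α * (4 * R ^ n * (Λ + N) / n * C) := by
    have h4 := hlam z hz
    have h5 : M.lam z ≤ Λ + N := by linarith [hlamΛ z hz]
    gcongr
    exact (hr z hz).2
  have c2 : α * (4 * M.r z ^ n * -M.nu z / n * C) ≤ α * (4 * R ^ n * (Λ + N) / n * C) := by
    have h4 : 0 ≤ -M.nu z := by linarith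
    have h5 : -M.nu z ≤ Λ + N := by linarith [hνN z hz]
    gcongr
    exact (hr z hz).2
  have hGC : 0 ≤ G ^ 2 * C := by positivity
  rw [e1, e2, abs_of_nonneg (M.Tvv_nonneg z hz'), abs_of_nonneg (M.Tuu_nonneg z hz')]
  rw [← hα] at b1 b2
  refine ⟨⟨?_, ?_⟩, ?_, ?_⟩ <;> linarith [b1.1, b1.2, b2.1, b2.2]

theorem exists_integral_bound (hC : 0 < C) : ∃ B : ℝ, ∀ q ∈ pastNhd p ε,
    (∫ u in (p.1 - ε)..q.1, |M.Tuu (u, q.2)|) ≤ B ∧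
    (∫ u in (p.1 - ε)..q.1, |M.Tuv (u, q.2)|) ≤ B ∧
    (∫ v in (p.2 - ε)..q.2, |M.Tuv (q.1, v)|) ≤ B ∧
    (∫ v in (p.2 - ε)..q.2, |M.Tvv (q.1, v)|) ≤ B := by
  have hlam : ∀ q ∈ pastNhd p ε, 0 ≤ M.lam q := fun q hq => hlam₀.le.trans (hreg q hq)
  obtain ⟨B, hB, hm⟩ := h.exists_mass_bound hn hlam hC
  obtain ⟨α, hα, β, hβ, hT⟩ := h.exists_stress_le hn hlam₀ hreg hC
  have hdv : ∀ z ∈ pastNhd p ε, HasDerivAt (fun v => α * M.mass (z.1, v) + β * v)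
      (α * (4 * M.r z ^ n / (n * M.Ω z ^ 2) * (M.lam z * M.Tuv z - M.nu z * M.Tvv z)) + β)
      z.2 := fun z hz =>
    ((M.hasDerivAt_mass_v hn (h.subset_interior hz)).const_mul α).fun_add
      (by simpa using (hasDerivAt_id z.2).const_mul β)
  have hdu : ∀ z ∈ pastNhd p ε, HasDerivAt (fun u => -α * M.mass (u, z.2) + β * u)
      (-α * (4 * M.r z ^ n / (n * M.Ω z ^ 2) * (M.nu z * M.Tuv z - M.lam z * M.Tuu z)) + β)
      z.1 := fun z hz =>
    ((M.hasDerivAt_mass_u hn (h.subset_interior hz)).const_mul (-α)).fun_add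
      (by simpa using (hasDerivAt_id z.1).const_mul β)
  -- The total variation allowed by `|m| ≤ B` along a null segment of length at most `ε`.
  refine ⟨2 * α * B + β * ε, fun q hq => ?_⟩
  have hl : (p.1 - ε, q.2) ∈ pastNhd p ε := h.segment_u hq ⟨le_rfl, h.fst_mem hq⟩
  have hb : (q.1, p.2 - ε) ∈ pastNhd p ε := h.segment_v hq ⟨le_rfl, h.snd_mem hq⟩
  have hv : α * M.mass q + β * q.2 - (α * M.mass (q.1, p.2 - ε) + β * (p.2 - ε))
      ≤ 2 * α * B + β * ε := by
    have h1 := mul_le_mul_of_nonneg_left (abs_le.1 (hm _ hq)).2 hα.le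
    have h2 := mul_le_mul_of_nonneg_left (abs_le.1 (hm _ hb)).1 hα.le
    have h3 := mul_le_mul_of_nonneg_left (h.mem_iff.1 hq).2.1.2 hβ.le
    linarith
  have hu : -α * M.mass q + β * q.1 - (-α * M.mass (p.1 - ε, q.2) + β * (p.1 - ε))
      ≤ 2 * α * B + β * ε := by
    have h1 := mul_le_mul_of_nonneg_left (abs_le.1 (hm _ hq)).1 hα.le
    have h2 := mul_le_mul_of_nonneg_left (abs_le.1 (hm _ hl)).2 hα.le
    have h3 := mul_le_mul_of_nonneg_left (h.mem_iff.1 hq).2.1.1 hβ.le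
    linarith
  exact ⟨(h.integral_u_le (f := fun z => -α * M.mass z + β * z.1) M.Tuu_continuous hdu
      (fun z hz => (hT z hz).2.2) hq).trans hu,
    (h.integral_u_le (f := fun z => -α * M.mass z + β * z.1) M.Tuv_continuous hdu
      (fun z hz => (hT z hz).2.1) hq).trans hu,
    (h.integral_v_le (f := fun z => α * M.mass z + β * z.2) M.Tuv_continuous hdv
      (fun z hz => (hT z hz).1.1) hq).trans hv,
    (h.integral_v_le (f := fun z => α * M.mass z + β * z.2) M.Tvv_continuous hdv
      (fun z hz => (hT z hz).1.2) hq).trans hv⟩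

end Admissible

/-! ### The extension criterion -/

omit M in
theorem c0Norm_lt_top {f : ℝ × ℝ → ℝ} {Y : Set (ℝ × ℝ)} {B : ℝ} (hf : ∀ q ∈ Y, |f q| ≤ B) :
    c0Norm f Y < ⊤ :=
  (iSup₂_le fun q hq => ENNReal.ofReal_le_ofReal (hf q hq)).trans_lt ENNReal.ofReal_lt_top

/-- The null corner is a compact generating set off the centre. If the six derivatives were bounded,
its extension norm would be finite: the `C²` norm of `r` consists of `r`, `ν`, `λ` and first
derivatives of `ν`, `λ`, and the derivatives of `1/r` are `-ν/r²` and `-λ/r²`. -/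
theorem Admissible.exists_derivative_gt (h : M.Admissible p ε) (hn : 2 ≤ n) (hC : 0 < C)
    (hp : M.IsFirstSingularity p) (hpΓ : p ∉ closure M.Γ) {lam₀ : ℝ} (hlam₀ : 0 < lam₀)
    (hreg : ∀ q ∈ pastNhd p ε, lam₀ ≤ M.lam q) (hext : M.ExtensionCriterion) (B : ℝ) :
    ∃ q ∈ pastNhd p ε, B < |du M.Ω q| ∨ B < |dv M.Ω q| ∨ B < |du M.lam q| ∨ B < |dv M.lam q| ∨
      B < |du M.nu q| ∨ B < |dv M.nu q| := by
  by_contra! hcon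
  obtain ⟨r₀, hr₀, B₁, h₁⟩ :=
    h.exists_bounds hn (fun q hq => hlam₀.le.trans (hreg q hq)) hC
  obtain ⟨_, _, B₂, h₂⟩ := h.exists_regular_bounds hn hlam₀ hreg hC
  have htop := hext p hp hpΓ _ h.nullCorner_subset h.generates
  set Y := (domainOfDependence (nullCorner p ε) \ {p}) ∩ (M.Q \ M.Γ)
  have hY : ∀ q ∈ Y, q ∈ pastNhd p ε := fun q hq => hq.1
  have hinv : ∀ q ∈ Y, ∀ x : ℝ, |x| ≤ B₁ → |-x / M.r q ^ 2| ≤ B₁ / r₀ ^ 2 := by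
    intro q hq x hx
    have hr := (h₁ q (hY q hq)).2.1
    rw [abs_div, abs_neg, abs_of_pos (pow_pos (hr₀.trans_le hr) 2)]
    have := (abs_nonneg x).trans hx
    gcongr
  have e1 : ∀ q ∈ Y, du (fun q => (M.r q)⁻¹) q = -M.nu q / M.r q ^ 2 := fun q hq =>
    ((Admissible.hasDerivAt_r_u hq.2).fun_inv (M.r_pos q hq.2).ne').deriv
  have e2 : ∀ q ∈ Y, dv (fun q => (M.r q)⁻¹) q = -M.lam q / M.r q ^ 2 := fun q hq =>
    ((Admissible.hasDerivAt_r_v hq.2).fun_inv (M.r_pos q hq.2).ne').deriv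
  have hr : ∀ q ∈ Y, |M.r q| ≤ B₁ := fun q hq => by
    rw [abs_of_pos (M.r_pos q hq.2)]
    exact (h₁ q (hY q hq)).2.2.1
  have hr' : ∀ q ∈ Y, |(M.r q)⁻¹| ≤ r₀⁻¹ := fun q hq => by
    rw [abs_of_pos (inv_pos.2 (M.r_pos q hq.2))]
    exact inv_anti₀ hr₀ (h₁ q (hY q hq)).2.1
  refine ne_of_lt ?_ htop
  simp only [extensionNorm, c2Norm, c1Norm, max_lt_iff]
  refine ⟨⟨⟨⟨⟨c0Norm_lt_top fun q hq => (h₁ q (hY q hq)).2.2.2.2.2,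
    c0Norm_lt_top fun q hq => (hcon q (hY q hq)).1⟩,
    c0Norm_lt_top fun q hq => (hcon q (hY q hq)).2.1⟩,
    c0Norm_lt_top fun q hq => (h₂ q (hY q hq)).2⟩,
    ⟨c0Norm_lt_top hr, ⟨c0Norm_lt_top fun q hq => (h₁ q (hY q hq)).2.2.2.1,
      c0Norm_lt_top fun q hq => (hcon q (hY q hq)).2.2.2.2.1⟩,
      c0Norm_lt_top fun q hq => (hcon q (hY q hq)).2.2.2.2.2⟩,
    ⟨c0Norm_lt_top fun q hq => (h₁ q (hY q hq)).2.2.2.2.1,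
      c0Norm_lt_top fun q hq => (hcon q (hY q hq)).2.2.1⟩,
      c0Norm_lt_top fun q hq => (hcon q (hY q hq)).2.2.2.1⟩,
    ⟨c0Norm_lt_top hr', c0Norm_lt_top (B := B₁ / r₀ ^ 2) fun q hq => ?_⟩,
    c0Norm_lt_top (B := B₁ / r₀ ^ 2) fun q hq => ?_⟩
  · rw [e1 q hq]
    exact hinv q hq _ (h₁ q (hY q hq)).2.2.2.1
  · rw [e2 q hq]
    exact hinv q hq _ (h₁ q (hY q hq)).2.2.2.2.1

end SymmetricSpacetime

end Collapse

end

/-! ### Assembly of the main theorem. -/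

theorem mainTheorem2 (n : ℕ) (hn : 2 ≤ n) (k C : ℝ) (hC : 0 < C)
    (M : Collapse.SymmetricSpacetime n k C) (p : ℝ × ℝ)
    (hp : M.IsFirstSingularity p) (hpΓ : p ∉ closure M.Γ) :
    -- arbitrarily small admissible past neighbourhoods exist
    (∃ ε₀ > 0, ∀ ε, 0 < ε → ε ≤ ε₀ →
      M.Admissible p ε ∧
      Collapse.nullCorner p ε ⊆ M.Q \ M.Γ ∧
      Collapse.domainOfDependence (Collapse.nullCorner p ε) = Set.Icc (p.1 - ε, p.2 - ε) p ∧
      Collapse.domainOfDependence (Collapse.nullCorner p ε) ∩ M.Q = Collapse.SymmetricSpacetime.pastNhd p ε) ∧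
    ∀ ε, M.Admissible p ε →
      -- without trapped points, `m`, `r`, `ν`, `λ` and `Ω` are bounded
      (Disjoint (Collapse.SymmetricSpacetime.pastNhd p ε) M.trapped →
        ∃ r₀ > 0, ∃ B : ℝ, ∀ q ∈ Collapse.SymmetricSpacetime.pastNhd p ε,
          |M.mass q| ≤ B ∧ r₀ ≤ M.r q ∧ M.r q ≤ B ∧
          |M.nu q| ≤ B ∧ |M.lam q| ≤ B ∧ |M.Ω q| ≤ B) ∧
      -- the regular region
      (∀ lam₀ > 0, (∀ q ∈ Collapse.SymmetricSpacetime.pastNhd p ε, lam₀ ≤ M.lam q) →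
        -- `|ν|` is bounded below and `Ω⁻¹` is bounded
        (∃ ν₀ > 0, ∃ B : ℝ, ∀ q ∈ Collapse.SymmetricSpacetime.pastNhd p ε, ν₀ ≤ |M.nu q| ∧ |(M.Ω q)⁻¹| ≤ B) ∧
        -- the stress tensor has uniformly bounded integrals along null segments
        (∃ B : ℝ, ∀ q ∈ Collapse.SymmetricSpacetime.pastNhd p ε,
          (∫ u in (p.1 - ε)..q.1, |M.Tuu (u, q.2)|) ≤ B ∧
          (∫ u in (p.1 - ε)..q.1, |M.Tuv (u, q.2)|) ≤ B ∧
          (∫ v in (p.2 - ε)..q.2, |M.Tuv (q.1, v)|) ≤ B ∧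
          (∫ v in (p.2 - ε)..q.2, |M.Tvv (q.1, v)|) ≤ B) ∧
        -- only derivatives of `Ω`, `λ` and `ν` can be, and under the extension criterion are,
        -- unbounded
        (M.ExtensionCriterion → ∀ B : ℝ, ∃ q ∈ Collapse.SymmetricSpacetime.pastNhd p ε,
          B < |Collapse.du M.Ω q| ∨ B < |Collapse.dv M.Ω q| ∨ B < |Collapse.du M.lam q| ∨
          B < |Collapse.dv M.lam q| ∨
          B < |Collapse.du M.nu q| ∨ B < |Collapse.dv M.nu q|)) := by
  refine ⟨?_, fun ε h => ⟨fun hT => ?_, fun lam₀ hlam₀ hreg => ⟨?_, ?_, ?_⟩⟩⟩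
  · obtain ⟨ε₀, hε₀, hadm⟩ := hp.exists_admissible hpΓ
    refine ⟨ε₀, hε₀, fun ε hε hle => ?_⟩
    have h := hadm ε hε hle
    refine ⟨h, h.nullCorner_subset, Collapse.domainOfDependence_nullCorner p hε, ?_⟩
    refine Set.Subset.antisymm (fun q hq => ⟨hq.1, fun e => ?_⟩) fun q hq =>
      ⟨hq.1, (h.subset_diff hq).1⟩
    exact hp.notMem ((Set.mem_singleton_iff.1 e) ▸ hq.2)
  · refine h.exists_bounds hn (fun q hq => ?_) hC
    by_contra! hlt
    exact Set.disjoint_left.1 hT hq ⟨(h.subset_diff hq).1, hlt⟩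
  · exact h.exists_regular_bounds hn hlam₀ hreg hC
  · exact h.exists_integral_bound hn hlam₀ hreg hC
  · exact h.exists_derivative_gt hn hC hp hpΓ hlam₀ hreg
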